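/- For $\alpha\in[0,\infty)$ and $\gamma\in(0,\infty]$, not both $\alpha=0$ and $\gamma=\infty$, let \[ f_{\alpha,\gamma}(x)=\frac{1}{2(\alpha+1/\gamma)}\,e^{-\gamma(|x|-\alpha)_+},\qquad x\in\mathbb R, \] where $\gamma=\infty$ is understood to give the uniform density on $[-\alpha,\alpha]$. For $\alpha\in(0,\infty]$ and $\gamma\in[0,\infty)$, not both $\alpha=\infty$ and $\gamma=0$, let \[ g_{\alpha,\gamma}(x)=\frac{\gamma}{2(1-e^{-\alpha\gamma})}\,e^{-\gamma|x|}\,\mathbf 1_{\{|x|\le\alpha\}},\qquad x\in\mathbb R, \] where $\gamma=0$ is understood to give the uniform density on $[-\alpha,\alpha]$ and $\alpha=\infty$ the two-sided exponential density $\frac{\gamma}{2}e^{-\gamma|x|}$. Let $\mathcal F^-$ be the set of all $f_{\alpha,\gamma}$ and $\mathcal F^+$ the set of all $g_{\alpha,\gamma}$. A real random variable is called log-concave if it has a density of the form $e^{-\phi}$ with $\phi\colon\mathbb R\to(-\infty,+\infty]$ convex. Let $p>4$, $n\ge 1$ and let $a_1,\dots,a_n,b_1,\dots,b_n>0$ satisfy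 \[ 3^{1/2}(p+1)^{-1/p}\ \le\ \frac{b_j}{a_j}\ \le\ 2^{-1/2}\,\Gamma(p+1)^{1/p},\qquad j=1,\dots,n. \] Then for every $j$ there are a unique $f_j^-\in\mathcal F^-$ and a unique $f_j^+\in\mathcal F^+$ with \[ \int_{\mathbb R}x^2f_j^{\pm}(x)\,dx=a_j^2\qquad\text{and}\qquad\int_{\mathbb R}|x|^pf_j^{\pm}(x)\,dx=b_j^p . \] Let $X_1^-,\dots,X_n^-$ be independent with densities $f_1^-,\dots,f_n^-$, and let $X_1^+,\dots,X_n^+$ be independent with densities $f_1^+,\dots,f_n^+$. Then \[ \inf\ \mathbb E\Big|\sum_{j=1}^nX_j\Big|^p=\mathbb E\Big|\sum_{j=1}^nX_j^-\Big|^p\qquad\text{and}\qquad \sup\ \mathbb E\Big|\sum_{j=1}^nX_j\Big|^p=\mathbb E\Big|\sum_{j=1}^nX_j^+\Big|^p, \] where the infimum and the supremum are taken over all sequences $(X_1,\dots,X_n)$ of independent symmetric log-concave random variables with $\mathbb E X_j^2=a_j^2$ and $\mathbb E|X_j|^p=b_j^p$ for all $j$. Both are attained: $(X_j^-)_j$ and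 $(X_j^+)_j$ are themselves such sequences. -/

import Mathlib

open MeasureTheory ProbabilityTheory
open scoped ENNReal

universe u

noncomputable section

namespace LogConcaveRosenthal

/-- The uniform density on `[-α, α]`. -/
def uniformDensity (α : ℝ) (x : ℝ) : ℝ :=
  if |x| ≤ α then 1 / (2 * α) else 0

/-- The density `f_{α,γ}`, equal to `exp (-γ (|x| - α)₊) / (2 (α + 1/γ))`, with the convention that
`γ = ∞` gives the uniform density on `[-α, α]`. -/
def flatExpDensity (α : ℝ) (γ : ℝ≥0∞) (x : ℝ) : ℝ :=
  if γ = ⊤ then uniformDensity α x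
  else 1 / (2 * (α + 1 / γ.toReal)) * Real.exp (-(γ.toReal * max (|x| - α) 0))

/-- The density `g_{α,γ}`, equal to `γ / (2 (1 - exp (-α γ))) * exp (-γ |x|)` on `|x| ≤ α` and to
`0` elsewhere, with the conventions that `γ = 0` gives the uniform density on `[-α, α]` and `α = ∞`
gives the two-sided exponential density. -/
def truncExpDensity (α : ℝ≥0∞) (γ : ℝ) (x : ℝ) : ℝ :=
  if γ = 0 then uniformDensity α.toReal x
  else if α = ⊤ then γ / 2 * Real.exp (-(γ * |x|))
  else if |x| ≤ α.toReal then
    γ / (2 * (1 - Real.exp (-(α.toReal * γ)))) * Real.exp (-(γ * |x|))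
  else 0

/-- The family `F⁻` of all `f_{α,γ}` with `α ∈ [0, ∞)`, `γ ∈ (0, ∞]`. The pair `α = 0`, `γ = ∞`,
to which no density corresponds, is left out. -/
def familyMinus : Set (ℝ → ℝ) :=
  {f | ∃ (α : ℝ) (γ : ℝ≥0∞), 0 ≤ α ∧ 0 < γ ∧ (γ = ⊤ → 0 < α) ∧ f = flatExpDensity α γ}

/-- The family `F⁺` of all `g_{α,γ}` with `α ∈ (0, ∞]`, `γ ∈ [0, ∞)`. The pair `α = ∞`, `γ = 0`,
to which no density corresponds, is left out. -/
def familyPlus : Set (ℝ → ℝ) :=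
  {g | ∃ (α : ℝ≥0∞) (γ : ℝ), 0 < α ∧ 0 ≤ γ ∧ (α = ⊤ → 0 < γ) ∧ g = truncExpDensity α γ}

/-- The density `f` has second moment `a ^ 2` and absolute `p`-th moment `b ^ p`. (For `a, b > 0`
the two integrals are non-zero, hence the integrands are integrable.) -/
def HasDensityMoments (p a b : ℝ) (f : ℝ → ℝ) : Prop :=
  ∫ x, x ^ 2 * f x = a ^ 2 ∧ ∫ x, |x| ^ p * f x = b ^ p

/-- `f` is the one and only member of the family `F` with second moment `a ^ 2` and absolute `p`-th
moment `b ^ p`. -/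
def IsUniqueDensity (F : Set (ℝ → ℝ)) (p a b : ℝ) (f : ℝ → ℝ) : Prop :=
  f ∈ F ∧ HasDensityMoments p a b f ∧ ∀ g ∈ F, HasDensityMoments p a b g → g = f

/-- The law on `ℝ` with density `f`. -/
def lawOfDensity (f : ℝ → ℝ) : Measure ℝ :=
  volume.withDensity fun x => ENNReal.ofReal (f x)

/-- `f = exp (-φ)` for a convex `φ : ℝ → (-∞, +∞]`. Such a `φ` is given by the convex set `K` where
it is finite and by its values on `K`, where it is a real-valued convex function. -/
def IsLogConcaveDensity (f : ℝ → ℝ) : Prop :=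
  ∃ (K : Set ℝ) (φ : ℝ → ℝ), ConvexOn ℝ K φ ∧ f = K.indicator fun x => Real.exp (-φ x)

/-- The random variable `X` is log-concave. -/
def IsLogConcave {Ω : Type u} [MeasurableSpace Ω] (X : Ω → ℝ) (μ : Measure Ω) : Prop :=
  ∃ f : ℝ → ℝ, IsLogConcaveDensity f ∧ μ.map X = lawOfDensity f

/-- `X = (X_1, …, X_n)` are independent symmetric log-concave random variables with
`E X_j ^ 2 = a_j ^ 2` and `E |X_j| ^ p = b_j ^ p`. -/
structure IsAdmissible {Ω : Type u} [MeasurableSpace Ω] (μ : Measure Ω) {n : ℕ}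
    (p : ℝ) (a b : Fin n → ℝ) (X : Fin n → Ω → ℝ) : Prop where
  measurable : ∀ j, Measurable (X j)
  indep : iIndepFun X μ
  symmetric : ∀ j, IdentDistrib (X j) (fun ω => -X j ω) μ μ
  logConcave : ∀ j, IsLogConcave (X j) μ
  second_moment : ∀ j, ∫ ω, X j ω ^ 2 ∂μ = a j ^ 2
  pth_moment : ∀ j, ∫ ω, |X j ω| ^ p ∂μ = b j ^ p

/-- The set of all values `E |X_1 + … + X_n| ^ p`, over all admissible sequences `X` on arbitrary
probability spaces. -/
def sumMoments {n : ℕ} (p : ℝ) (a b : Fin n → ℝ) : Set ℝ :=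
  {v | ∃ (Ω : Type u) (_ : MeasurableSpace Ω) (μ : Measure Ω) (X : Fin n → Ω → ℝ),
    IsProbabilityMeasure μ ∧ IsAdmissible μ p a b X ∧ v = ∫ ω, |∑ j, X j ω| ^ p ∂μ}

/-- `E |X_1 + … + X_n| ^ p` for independent `X_j` with densities `f_j`, realised as the coordinates
of `ℝⁿ` under the product law. -/
def sumMomentOfDensities {n : ℕ} (p : ℝ) (f : Fin n → ℝ → ℝ) : ℝ :=
  ∫ x : Fin n → ℝ, |∑ j, x j| ^ p ∂(Measure.pi fun j => lawOfDensity (f j))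

end LogConcaveRosenthal

end

/-! Compare an even log-concave density f with an extremal density g having the same moments. Put D
= f - g for g in `familyMinus` and D = g - f for g in `familyPlus`; then D is even and orthogonal to
1, x² and |x|^p. On (0, ∞) it never takes the signs -, +, -, + in this order
(`noAlternation_sub_flat`, `noAlternation_logConvex_sub`). The reason is that f is log-concave and
nonincreasing there, while members of `familyMinus` are flat and then log-affine or zero, and
members of `familyPlus` are log-affine on their support. So, up to null sets, D has signs +, -, +, -
with breakpoints x₁ < x₂ < x₃, or fewer sign changes.

In the first case interpolate h(x) = |x + s|^p + |x - s|^p at the breakpoints by 1, x², x^p. The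
error also has signs +, -, +, - (`exists_three_point_symPow`): two weighted differentiations turn it
into a strictly monotone function, and Rolle's theorem allows no further zeros. That monotonicity
(`strictMonoOn_kernelRatio`) rests on p > 4. The interpolant integrates to 0 against D, hence ∫ h D
= ∫ error · D ≥ 0. With fewer sign changes, some combination of 1, x², x^p itself has the signs of
D, which forces D = 0 almost everywhere.

Thus E|X + s|^p is extremal for every real s (`integral_shift_nonneg`). By independence the summands
can be exchanged successively, the others acting as the shift s (`lintegral_sum_rpow_mono`).

Two members of the same family can be compared in both directions, so the equality case gives
uniqueness. Existence is an intermediate value argument for a scale-invariant moment ratio, running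
from the uniform to the exponential density (`exists_scale`). -/

noncomputable section

namespace LogConcaveRosenthal

open Set

/-! ### The kernel function and its monotonicity -/

/-- Strict tangent line inequality for `t ↦ t ^ q` at the right endpoint. -/
lemma rpow_sub_lt_tangent {q : ℝ} (hq : 1 < q) {A B : ℝ} (hB : 0 ≤ B) (hAB : B < A) :
    A ^ q - B ^ q < q * A ^ (q - 1) * (A - B) := by
  have hA : 0 < A := hB.trans_lt hAB
  have h1 := one_add_mul_self_lt_rpow_one_add (s := B / A - 1)
    (by have : 0 ≤ B / A := by positivity
        linarith)
    (by
      have : B / A < 1 := (div_lt_one hA).2 hAB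
      linarith) hq
  have h2 : (1 + (B / A - 1)) = B / A := by ring
  rw [h2, Real.div_rpow hB hA.le, lt_div_iff₀ (by positivity)] at h1
  have h3 : A ^ q = A ^ (q - 1) * A := by
    rw [← Real.rpow_add_one hA.ne']; ring_nf
  have h4 : (1 + q * (B / A - 1)) * A ^ q = A ^ q + q * A ^ (q - 1) * (B - A) := by
    rw [h3]; field_simp
  rw [h4] at h1
  linarith

/-- The trapezoidal rule strictly overestimates the integral of `t ↦ t ^ q`. -/
lemma rpow_sub_lt_trapezoid {q : ℝ} (hq : 1 < q) {A B : ℝ} (hB : 0 ≤ B) (hAB : B < A) :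
    A ^ (q + 1) - B ^ (q + 1) < (q + 1) * ((A - B) * (A ^ q + B ^ q) / 2) := by
  -- The trapezoid bound minus `t ^ (q + 1)`, as a function of the upper endpoint. Its derivative is
  -- a positive multiple of the gap in the tangent inequality.
  let F : ℝ → ℝ := fun t => (q + 1) * ((t - B) * (t ^ q + B ^ q) / 2) - t ^ (q + 1)
  have hd : ∀ t, HasDerivAt F
      ((q + 1) / 2 * (B ^ q - t ^ q + q * t ^ (q - 1) * (t - B))) t := by
    intro t
    have h1 : HasDerivAt (fun t : ℝ => t ^ q) (q * t ^ (q - 1)) t :=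
      Real.hasDerivAt_rpow_const (Or.inr hq.le)
    have h2 : HasDerivAt (fun t : ℝ => t ^ (q + 1)) ((q + 1) * t ^ (q + 1 - 1)) t :=
      Real.hasDerivAt_rpow_const (Or.inr (by linarith))
    have h3 := (((((hasDerivAt_id t).sub_const B).mul (h1.add_const (B ^ q))).div_const 2).const_mul
      (q + 1)).sub h2
    refine h3.congr_deriv ?_
    simp only [add_sub_cancel_right, id]
    ring
  have hmono : StrictMonoOn F (Icc B A) := by
    refine strictMonoOn_of_deriv_pos (convex_Icc B A)
      (fun t _ => (hd t).continuousAt.continuousWithinAt) fun t ht => ?_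
    rw [interior_Icc] at ht
    rw [(hd t).deriv]
    have := rpow_sub_lt_tangent hq hB ht.1
    apply mul_pos <;> linarith
  have := hmono (left_mem_Icc.2 hAB.le) (right_mem_Icc.2 hAB.le) hAB
  simp only [F, sub_self, zero_mul, zero_div, mul_zero, zero_sub] at this
  linarith

/-- The function whose value at `s / x` is, up to a factor, `x ^ (3 - p)` times the derivative of
`x ↦ h' x / x`, where `h x = |x + s| ^ p + |x - s| ^ p`. -/
def kernelRatio (p y : ℝ) : ℝ :=
  (p - 1) * ((1 + y) ^ (p - 2) + |1 - y| ^ (p - 2))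
    - ((1 + y) ^ (p - 1) + |1 - y| ^ (p - 2) * (1 - y))

lemma hasDerivAt_abs_rpow_mul_self {r : ℝ} (hr : 1 < r) (x : ℝ) :
    HasDerivAt (fun x : ℝ => |x| ^ r * x) ((r + 1) * |x| ^ r) x := by
  refine ((hasDerivAt_abs_rpow x hr).mul (hasDerivAt_id x)).congr_deriv ?_
  have h : |x| ^ (r - 2) * x * x = |x| ^ r := by
    rcases eq_or_ne x 0 with rfl | hx
    · simp [Real.zero_rpow (show r ≠ 0 by linarith)]
    · have hx' : 0 < |x| := abs_pos.2 hx
      have : |x| ^ r = |x| ^ (r - 2) * |x| ^ (2 : ℝ) := by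
        rw [← Real.rpow_add hx']; ring_nf
      rw [this, Real.rpow_two, sq_abs]; ring
  simp only [id, mul_one]
  linear_combination r * h

/-- This is the derivative of `kernelRatio` divided by p - 1. The trapezoid inequality applies with
exponent q = p - 3 > 1 at the points A = 1 + y, B = |1 - y|. For y ≥ 1 one has A - B = 2 and it is
exactly the claim. For y < 1 one has A - B = 2y, and y (A^q + B^q) ≤ A^q - B^q because the
difference is AB (A^(q-1) - B^(q-1)). -/
lemma kernelRatio_deriv_pos {p : ℝ} (hp : 4 < p) {y : ℝ} (hy : 0 < y) :
    0 < (p - 2) * ((1 + y) ^ (p - 3) - |1 - y| ^ (p - 4) * (1 - y))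
      - ((1 + y) ^ (p - 2) - |1 - y| ^ (p - 2)) := by
  have hq : 1 < p - 3 := by linarith
  have e : p - 3 + 1 = p - 2 := by ring
  rcases lt_or_ge y 1 with h1 | h1
  · have hB : 0 < 1 - y := by linarith
    have hA : 0 < 1 + y := by linarith
    have ht := rpow_sub_lt_trapezoid hq hB.le (show 1 - y < 1 + y by linarith)
    rw [e] at ht
    rw [abs_of_pos hB]
    have e2 : (1 - y) ^ (p - 4) * (1 - y) = (1 - y) ^ (p - 3) := by
      rw [← Real.rpow_add_one hB.ne']; ring_nf
    rw [e2]
    have e3 : (1 + y) ^ (p - 4) * (1 + y) = (1 + y) ^ (p - 3) := by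
      rw [← Real.rpow_add_one hA.ne']; ring_nf
    have h4 : (1 - y) ^ (p - 4) ≤ (1 + y) ^ (p - 4) :=
      Real.rpow_le_rpow hB.le (by linarith) (by linarith)
    have h5 : y * ((1 + y) ^ (p - 3) + (1 - y) ^ (p - 3)) ≤ (1 + y) ^ (p - 3) - (1 - y) ^ (p - 3) := by
      rw [← e2, ← e3]
      nlinarith [mul_nonneg (mul_pos hA hB).le (sub_nonneg.2 h4)]
    have h6 := mul_le_mul_of_nonneg_left h5 (show 0 ≤ p - 2 by linarith)
    nlinarith
  · have hB : 0 ≤ y - 1 := by linarith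
    have ht := rpow_sub_lt_trapezoid hq hB (show y - 1 < 1 + y by linarith)
    rw [e] at ht
    rw [abs_sub_comm, abs_of_nonneg hB]
    have e2 : (y - 1) ^ (p - 4) * (1 - y) = - (y - 1) ^ (p - 3) := by
      rcases hB.eq_or_lt with h | h
      · rw [show 1 - y = 0 by linarith, ← h, mul_zero, Real.zero_rpow (by linarith), neg_zero]
      · have : (y - 1) ^ (p - 3) = (y - 1) ^ (p - 4) * (y - 1) := by
          rw [← Real.rpow_add_one h.ne']; ring_nf
        rw [this]; ring
    rw [e2]
    nlinarith

lemma strictMonoOn_kernelRatio {p : ℝ} (hp : 4 < p) :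
    StrictMonoOn (kernelRatio p) (Ioi 0) := by
  have hd : ∀ y ∈ Ioi (0 : ℝ), HasDerivAt (kernelRatio p)
      ((p - 1) * ((p - 2) * ((1 + y) ^ (p - 3) - |1 - y| ^ (p - 4) * (1 - y))
      - ((1 + y) ^ (p - 2) - |1 - y| ^ (p - 2)))) y := by
    intro y hy
    have hs : HasDerivAt (fun y : ℝ => 1 - y) (-1) y := by
      simpa using (hasDerivAt_id y).const_sub 1
    have ha : HasDerivAt (fun y : ℝ => 1 + y) 1 y := by
      simpa using (hasDerivAt_id y).const_add 1
    have h1 := ha.rpow_const (p := p - 2) (Or.inr (by linarith))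
    have h2 := ha.rpow_const (p := p - 1) (Or.inr (by linarith))
    have h3 := (hasDerivAt_abs_rpow (1 - y) (p := p - 2) (by linarith)).comp y hs
    have h4 := (hasDerivAt_abs_rpow_mul_self (r := p - 2) (by linarith) (1 - y)).comp y hs
    refine (((h1.add h3).const_mul (p - 1)).sub (h2.add h4)).congr_deriv ?_
    rw [show p - 2 - 2 = p - 4 by ring, show p - 2 - 1 = p - 3 by ring,
      show p - 1 - 1 = p - 2 by ring]
    ring
  refine strictMonoOn_of_deriv_pos (convex_Ioi 0)
    (fun y hy => (hd y hy).continuousAt.continuousWithinAt) fun y hy => ?_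
  rw [interior_Ioi] at hy
  rw [(hd y hy).deriv]
  exact mul_pos (by linarith) (kernelRatio_deriv_pos hp hy)

/-- The even function `x ↦ |x + s| ^ p + |x - s| ^ p`. -/
def symPow (p s x : ℝ) : ℝ := |x + s| ^ p + |x - s| ^ p

/-- The derivative of `symPow p s` at `x`, divided by `x`. -/
def symPowSlope (p s x : ℝ) : ℝ :=
  p * (|x + s| ^ (p - 2) * (x + s) + |x - s| ^ (p - 2) * (x - s)) / x

lemma hasDerivAt_symPow {p : ℝ} (hp : 4 < p) (s : ℝ) {x : ℝ} (hx : 0 < x) :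
    HasDerivAt (symPow p s) (x * symPowSlope p s x) x := by
  have ha : HasDerivAt (fun y : ℝ => y + s) 1 x := (hasDerivAt_id x).add_const s
  have hs : HasDerivAt (fun y : ℝ => y - s) 1 x := (hasDerivAt_id x).sub_const s
  have h1 := (hasDerivAt_abs_rpow (x + s) (p := p) (by linarith)).comp x ha
  have h2 := (hasDerivAt_abs_rpow (x - s) (p := p) (by linarith)).comp x hs
  refine (h1.add h2).congr_deriv ?_
  unfold symPowSlope
  field_simp

/-- By homogeneity in (x, s) the derivative is a power of x times a function of s / x alone. The
weight x^(p-3) is also that of the derivative of x^(p-2), so the x^p term of an interpolant will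
contribute only a constant after dividing by it. -/
lemma hasDerivAt_symPowSlope {p : ℝ} (hp : 4 < p) {s : ℝ} (hs0 : 0 < s) {x : ℝ} (hx : 0 < x) :
    HasDerivAt (symPowSlope p s) (x ^ (p - 3) * (p * kernelRatio p (s / x))) x := by
  have ha : HasDerivAt (fun y : ℝ => y + s) 1 x := (hasDerivAt_id x).add_const s
  have hs : HasDerivAt (fun y : ℝ => y - s) 1 x := (hasDerivAt_id x).sub_const s
  have h1 := (hasDerivAt_abs_rpow_mul_self (r := p - 2) (by linarith) (x + s)).comp x ha
  have h2 := (hasDerivAt_abs_rpow_mul_self (r := p - 2) (by linarith) (x - s)).comp x hs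
  refine (((h1.add h2).const_mul p).div (hasDerivAt_id x) hx.ne').congr_deriv ?_
  have e1 : |x + s| ^ (p - 2) = x ^ (p - 2) * (1 + s / x) ^ (p - 2) := by
    rw [← Real.mul_rpow hx.le (by positivity), abs_of_pos (by positivity)]
    congr 1; field_simp
  have e2 : |x - s| ^ (p - 2) = x ^ (p - 2) * |1 - s / x| ^ (p - 2) := by
    rw [← Real.mul_rpow hx.le (by positivity)]
    congr 1
    rw [← abs_of_pos hx, ← abs_mul, abs_of_pos hx]
    congr 1; field_simp
  have e3 : (1 + s / x) ^ (p - 1) = (1 + s / x) ^ (p - 2) * (1 + s / x) := by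
    rw [← Real.rpow_add_one (by positivity)]; ring_nf
  have e4 : x ^ (p - 2) = x ^ (p - 3) * x := by
    rw [← Real.rpow_add_one hx.ne']; ring_nf
  simp only [Pi.add_apply, Function.comp_apply, id, kernelRatio]
  rw [e1, e2, e3, e4]
  field_simp
  ring

/-! ### Sign patterns of interpolation errors -/

/-- A function with two weighted derivatives, the last of which is strictly decreasing, has signs
`+, -, +, -` if it vanishes at three points. -/
lemma signs_of_three_zeros {W V g m : ℝ → ℝ}
    (hW : ∀ x, 0 < x → HasDerivAt W (x * V x) x)
    (hV : ∀ x, 0 < x → HasDerivAt V (m x * g x) x) (hm : ∀ x, 0 < x → 0 < m x)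
    (hg : StrictAntiOn g (Ioi 0)) {x₁ x₂ x₃ : ℝ} (h0 : 0 < x₁) (h12 : x₁ < x₂) (h23 : x₂ < x₃)
    (z₁ : W x₁ = 0) (z₂ : W x₂ = 0) (z₃ : W x₃ = 0) :
    (∀ x ∈ Ioo 0 x₁, 0 < W x) ∧ (∀ x ∈ Ioo x₁ x₂, W x < 0) ∧ (∀ x ∈ Ioo x₂ x₃, 0 < W x) ∧
      ∀ x ∈ Ioi x₃, W x < 0 := by
  have hWc : ∀ a b : ℝ, 0 < a → ContinuousOn W (Icc a b) := fun a b ha x hx =>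
    (hW x (ha.trans_le hx.1)).continuousAt.continuousWithinAt
  -- Rolle twice: three zeros of W give zeros ξ < ζ of V, and these give a zero η of g. The sign of
  -- g then fixes the monotonicity of V, and the signs of V fix that of W.
  obtain ⟨ξ, hξ, hξ0⟩ := exists_hasDerivAt_eq_zero h12 (hWc _ _ h0) (z₁.trans z₂.symm)
    fun x hx => hW x (h0.trans hx.1)
  obtain ⟨ζ, hζ, hζ0⟩ := exists_hasDerivAt_eq_zero h23 (hWc _ _ (h0.trans h12)) (z₂.trans z₃.symm)
    fun x hx => hW x ((h0.trans h12).trans hx.1)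
  have hξp : 0 < ξ := h0.trans hξ.1
  have hζp : 0 < ζ := (h0.trans h12).trans hζ.1
  have hξζ : ξ < ζ := hξ.2.trans hζ.1
  have vξ : V ξ = 0 := by simpa [hξp.ne'] using hξ0
  have vζ : V ζ = 0 := by simpa [hζp.ne'] using hζ0
  obtain ⟨η, hη, hη0⟩ := exists_hasDerivAt_eq_zero hξζ
    (fun x hx => (hV x (hξp.trans_le hx.1)).continuousAt.continuousWithinAt) (vξ.trans vζ.symm)
    fun x hx => hV x (hξp.trans hx.1)
  have hηp : 0 < η := hξp.trans hη.1
  have gη : g η = 0 := by simpa [(hm η hηp).ne'] using hη0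
  have hVinc : StrictMonoOn V (Ioc 0 η) := by
    refine strictMonoOn_of_deriv_pos (convex_Ioc 0 η)
      (fun x hx => (hV x hx.1).continuousAt.continuousWithinAt) fun x hx => ?_
    rw [interior_Ioc] at hx
    rw [(hV x hx.1).deriv]
    exact mul_pos (hm x hx.1) (gη ▸ hg hx.1 hηp hx.2)
  have hVdec : StrictAntiOn V (Ici η) := by
    refine strictAntiOn_of_deriv_neg (convex_Ici η)
      (fun x hx => (hV x (hηp.trans_le hx)).continuousAt.continuousWithinAt) fun x hx => ?_
    rw [interior_Ici] at hx
    have hx0 : 0 < x := hηp.trans hx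
    rw [(hV x hx0).deriv]
    exact mul_neg_of_pos_of_neg (hm x hx0) (gη ▸ hg hηp hx0 hx)
  have V1 : ∀ x ∈ Ioo 0 ξ, V x < 0 := fun x hx =>
    vξ ▸ hVinc ⟨hx.1, (hx.2.trans hη.1).le⟩ ⟨hξp, hη.1.le⟩ hx.2
  have V2 : ∀ x ∈ Ioo ξ ζ, 0 < V x := by
    intro x hx
    rcases le_total x η with h | h
    · exact vξ ▸ hVinc ⟨hξp, hη.1.le⟩ ⟨hξp.trans hx.1, h⟩ hx.1
    · exact vζ ▸ hVdec h hη.2.le hx.2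
  have V3 : ∀ x ∈ Ioi ζ, V x < 0 := fun x hx =>
    vζ ▸ hVdec hη.2.le (hη.2.trans hx).le hx
  have W1 : StrictAntiOn W (Ioc 0 ξ) := by
    refine strictAntiOn_of_deriv_neg (convex_Ioc 0 ξ)
      (fun x hx => (hW x hx.1).continuousAt.continuousWithinAt) fun x hx => ?_
    rw [interior_Ioc] at hx
    rw [(hW x hx.1).deriv]
    exact mul_neg_of_pos_of_neg hx.1 (V1 x hx)
  have W2 : StrictMonoOn W (Icc ξ ζ) := by
    refine strictMonoOn_of_deriv_pos (convex_Icc ξ ζ) (hWc _ _ hξp) fun x hx => ?_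
    rw [interior_Icc] at hx
    rw [(hW x (hξp.trans hx.1)).deriv]
    exact mul_pos (hξp.trans hx.1) (V2 x hx)
  have W3 : StrictAntiOn W (Ici ζ) := by
    refine strictAntiOn_of_deriv_neg (convex_Ici ζ)
      (fun x hx => (hW x (hζp.trans_le hx)).continuousAt.continuousWithinAt) fun x hx => ?_
    rw [interior_Ici] at hx
    rw [(hW x (hζp.trans hx)).deriv]
    exact mul_neg_of_pos_of_neg (hζp.trans hx) (V3 x hx)
  refine ⟨fun x hx => ?_, fun x hx => ?_, fun x hx => ?_, fun x hx => ?_⟩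
  · exact z₁ ▸ W1 ⟨hx.1, (hx.2.trans hξ.1).le⟩ ⟨h0, hξ.1.le⟩ hx.2
  · rcases le_total x ξ with h | h
    · exact z₁ ▸ W1 ⟨h0, hξ.1.le⟩ ⟨h0.trans hx.1, h⟩ hx.1
    · exact z₂ ▸ W2 ⟨h, (hx.2.trans hζ.1).le⟩ ⟨hξ.2.le, hζ.1.le⟩ hx.2
  · rcases le_total x ζ with h | h
    · exact z₂ ▸ W2 ⟨hξ.2.le, hζ.1.le⟩ ⟨(hξ.2.trans hx.1).le, h⟩ hx.1
    · exact z₃ ▸ W3 h hζ.2.le hx.2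
  · exact z₃ ▸ W3 hζ.2.le (hζ.2.trans hx).le hx

/-- A function with a strictly increasing weighted derivative has signs `+, -, +` if it vanishes at
two points. -/
lemma signs_of_two_zeros {W V : ℝ → ℝ} (hW : ∀ x, 0 < x → HasDerivAt W (x * V x) x)
    (hV : StrictMonoOn V (Ioi 0)) {x₁ x₂ : ℝ} (h0 : 0 < x₁) (h12 : x₁ < x₂)
    (z₁ : W x₁ = 0) (z₂ : W x₂ = 0) :
    (∀ x ∈ Ioo 0 x₁, 0 < W x) ∧ (∀ x ∈ Ioo x₁ x₂, W x < 0) ∧ ∀ x ∈ Ioi x₂, 0 < W x := by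
  have hWc : ∀ a b : ℝ, 0 < a → ContinuousOn W (Icc a b) := fun a b ha x hx =>
    (hW x (ha.trans_le hx.1)).continuousAt.continuousWithinAt
  obtain ⟨ξ, hξ, hξ0⟩ := exists_hasDerivAt_eq_zero h12 (hWc _ _ h0) (z₁.trans z₂.symm)
    fun x hx => hW x (h0.trans hx.1)
  have hξp : 0 < ξ := h0.trans hξ.1
  have vξ : V ξ = 0 := by simpa [hξp.ne'] using hξ0
  have W1 : StrictAntiOn W (Ioc 0 ξ) := by
    refine strictAntiOn_of_deriv_neg (convex_Ioc 0 ξ)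
      (fun x hx => (hW x hx.1).continuousAt.continuousWithinAt) fun x hx => ?_
    rw [interior_Ioc] at hx
    rw [(hW x hx.1).deriv]
    exact mul_neg_of_pos_of_neg hx.1 (vξ ▸ hV hx.1 hξp hx.2)
  have W2 : StrictMonoOn W (Ici ξ) := by
    refine strictMonoOn_of_deriv_pos (convex_Ici ξ)
      (fun x hx => (hW x (hξp.trans_le hx)).continuousAt.continuousWithinAt) fun x hx => ?_
    rw [interior_Ici] at hx
    have hx0 : 0 < x := hξp.trans hx
    rw [(hW x hx0).deriv]
    exact mul_pos hx0 (vξ ▸ hV hξp hx0 hx)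
  refine ⟨fun x hx => ?_, fun x hx => ?_, fun x hx => ?_⟩
  · exact z₁ ▸ W1 ⟨hx.1, (hx.2.trans hξ.1).le⟩ ⟨h0, hξ.1.le⟩ hx.2
  · rcases le_total x ξ with h | h
    · exact z₁ ▸ W1 ⟨h0, hξ.1.le⟩ ⟨h0.trans hx.1, h⟩ hx.1
    · exact z₂ ▸ W2 h hξ.2.le hx.2
  · exact z₂ ▸ W2 hξ.2.le (hξ.2.trans hx).le hx

lemma hasDerivAt_powerCombination {p : ℝ} (hp : 4 < p) (c₀ c₁ c₂ : ℝ) {x : ℝ} (hx : 0 < x) :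
    HasDerivAt (fun x => c₀ + c₁ * x ^ 2 + c₂ * x ^ p)
      (x * (2 * c₁ + c₂ * p * x ^ (p - 2))) x := by
  have h1 : HasDerivAt (fun x : ℝ => x ^ p) (p * x ^ (p - 1)) x :=
    Real.hasDerivAt_rpow_const (Or.inr (by linarith))
  refine ((((hasDerivAt_pow 2 x).const_mul c₁).const_add c₀).add (h1.const_mul c₂)).congr_deriv ?_
  have : x ^ (p - 1) = x ^ (p - 2) * x := by
    rw [← Real.rpow_add_one hx.ne']; ring_nf
  rw [this]
  push_cast
  ring

/-- Interpolation at two points by `1, x ^ 2`, with the error term `x ^ p`. -/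
lemma exists_two_point_power {p : ℝ} (hp : 4 < p) {x₁ x₂ : ℝ} (h0 : 0 < x₁) (h12 : x₁ < x₂) :
    ∃ c₀ c₁ : ℝ, ∀ W : ℝ → ℝ, (W = fun x => c₀ + c₁ * x ^ 2 + 1 * x ^ p) →
      W x₁ = 0 ∧ W x₂ = 0 ∧
      (∀ x ∈ Ioo 0 x₁, 0 < W x) ∧ (∀ x ∈ Ioo x₁ x₂, W x < 0) ∧ ∀ x ∈ Ioi x₂, 0 < W x := by
  have hd : x₂ ^ 2 - x₁ ^ 2 ≠ 0 := by nlinarith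
  -- The coefficients subtract from x^p its secant through x₁ and x₂, taken in the variable x².
  refine ⟨-x₁ ^ p + (x₂ ^ p - x₁ ^ p) / (x₂ ^ 2 - x₁ ^ 2) * x₁ ^ 2,
    -((x₂ ^ p - x₁ ^ p) / (x₂ ^ 2 - x₁ ^ 2)), ?_⟩
  rintro W rfl
  have z₁ : (fun x : ℝ => -x₁ ^ p + (x₂ ^ p - x₁ ^ p) / (x₂ ^ 2 - x₁ ^ 2) * x₁ ^ 2 +
    -((x₂ ^ p - x₁ ^ p) / (x₂ ^ 2 - x₁ ^ 2)) * x ^ 2 + 1 * x ^ p) x₁ = 0 := by ring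
  have z₂ : (fun x : ℝ => -x₁ ^ p + (x₂ ^ p - x₁ ^ p) / (x₂ ^ 2 - x₁ ^ 2) * x₁ ^ 2 +
    -((x₂ ^ p - x₁ ^ p) / (x₂ ^ 2 - x₁ ^ 2)) * x ^ 2 + 1 * x ^ p) x₂ = 0 := by
    simp only; field_simp; ring
  refine ⟨z₁, z₂, signs_of_two_zeros (fun x hx => hasDerivAt_powerCombination hp _ _ _ hx) ?_
    h0 h12 z₁ z₂⟩
  intro x hx y hy hxy
  have : x ^ (p - 2) < y ^ (p - 2) := Real.rpow_lt_rpow (le_of_lt hx) hxy (by linarith)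
  have hp0 : 0 < p := by linarith
  nlinarith

/-- Interpolation of `symPow p s` at three points by `1, x ^ 2, x ^ p`. -/
lemma exists_three_point_symPow {p : ℝ} (hp : 4 < p) {s : ℝ} (hs : 0 < s) {x₁ x₂ x₃ : ℝ}
    (h0 : 0 < x₁) (h12 : x₁ < x₂) (h23 : x₂ < x₃) :
    ∃ c₀ c₁ c₂ : ℝ, ∀ W : ℝ → ℝ, (W = fun x => symPow p s x + (c₀ + c₁ * x ^ 2 + c₂ * x ^ p)) →
      (∀ x ∈ Ioo 0 x₁, 0 < W x) ∧ (∀ x ∈ Ioo x₁ x₂, W x < 0) ∧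
      (∀ x ∈ Ioo x₂ x₃, 0 < W x) ∧ ∀ x ∈ Ioi x₃, W x < 0 := by
  -- Newton interpolation: this function vanishes at x₁, x₂ and is positive at x₃, so a multiple of
  -- it corrects the value at x₃ of the secant in x².
  obtain ⟨d₀, d₁, hd⟩ := exists_two_point_power hp h0 h12
  obtain ⟨e₁, e₂, -, -, e₃⟩ := hd _ rfl
  have hpos := e₃ x₃ h23
  beta_reduce at e₁ e₂ hpos
  set Q := d₀ + d₁ * x₃ ^ 2 + 1 * x₃ ^ p with hQ
  have hne : x₂ ^ 2 - x₁ ^ 2 ≠ 0 := by nlinarith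
  set sl := (symPow p s x₂ - symPow p s x₁) / (x₂ ^ 2 - x₁ ^ 2) with hsl
  set r := symPow p s x₃ - symPow p s x₁ - sl * (x₃ ^ 2 - x₁ ^ 2) with hr
  refine ⟨-symPow p s x₁ + sl * x₁ ^ 2 - r / Q * d₀, -sl - r / Q * d₁, - (r / Q), ?_⟩
  rintro W rfl
  have hsl' : sl * (x₂ ^ 2 - x₁ ^ 2) = symPow p s x₂ - symPow p s x₁ := by
    rw [hsl]; field_simp
  have hQ' : r / Q * Q = r := by field_simp
  refine signs_of_three_zeros (m := fun x => x ^ (p - 3))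
    (V := fun x => symPowSlope p s x + (2 * (-sl - r / Q * d₁) + -(r / Q) * p * x ^ (p - 2)))
    (g := fun x => p * kernelRatio p (s / x) + -(r / Q) * p * (p - 2))
    (fun x hx => ?_) (fun x hx => ?_) (fun x hx => Real.rpow_pos_of_pos hx _) ?_ h0 h12 h23
    ?_ ?_ ?_
  · refine ((hasDerivAt_symPow hp s hx).add (hasDerivAt_powerCombination hp _ _ _ hx)).congr_deriv ?_
    ring
  · have h1 : HasDerivAt (fun x : ℝ => x ^ (p - 2)) ((p - 2) * x ^ (p - 2 - 1)) x :=
      Real.hasDerivAt_rpow_const (Or.inr (by linarith))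
    refine ((hasDerivAt_symPowSlope hp hs hx).add ((h1.const_mul (-(r / Q) * p)).const_add
      (2 * (-sl - r / Q * d₁)))).congr_deriv ?_
    rw [show p - 2 - 1 = p - 3 by ring]
    ring
  · intro x hx y hy hxy
    have := strictMonoOn_kernelRatio hp (div_pos hs hy) (div_pos hs hx)
      (div_lt_div_of_pos_left hs hx hxy)
    have hp0 : 0 < p := by linarith
    nlinarith
  · linear_combination (- (r / Q)) * e₁
  · linear_combination (- (r / Q)) * e₂ - hsl'
  · rw [hQ] at hQ'
    linear_combination hr - hQ'

/-! ### Sign patterns -/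

/-- On `(a, ∞)` the function `D` has signs `+, -, +, …` on at most `k + 1` consecutive non-empty
intervals, up to null sets. -/
def SignPattern : ℕ → (ℝ → ℝ) → ℝ → Prop
  | 0, D, a => ∀ᵐ x, a < x → 0 ≤ D x
  | k + 1, D, a => ∃ s, a < s ∧ (∀ᵐ x, x ∈ Ioo a s → 0 ≤ D x) ∧ SignPattern k (-D) s

/-- There are no `a < x₀ < x₁ < … < x_k` at which `D` has the strict signs `-, +, -, …`. -/
def NoAlternation : ℕ → (ℝ → ℝ) → ℝ → Prop
  | 0, D, a => ∀ x, a < x → 0 ≤ D x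
  | k + 1, D, a => ∀ x, a < x → D x < 0 → NoAlternation k (-D) x

/-- Adjacent intervals with the same sign merge into one block, their common endpoint being null. -/
lemma SignPattern.extend {m : ℕ} {D : ℝ → ℝ} {a s : ℝ} (has : a ≤ s)
    (h : ∀ᵐ x, x ∈ Ioo a s → 0 ≤ D x) (hs : SignPattern m D s) : SignPattern m D a := by
  have hne : ∀ᵐ x : ℝ, x ≠ s := Measure.ae_ne volume s
  cases m with
  | zero =>
    filter_upwards [h, hs, hne] with x h1 h2 h3 hx
    rcases lt_or_gt_of_ne h3 with h4 | h4
    · exact h1 ⟨hx, h4⟩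
    · exact h2 h4
  | succ m =>
    obtain ⟨r, hsr, h1, h2⟩ := hs
    refine ⟨r, has.trans_lt hsr, ?_, h2⟩
    filter_upwards [h, h1, hne] with x h1 h2 h3 hx
    rcases lt_or_gt_of_ne h3 with h4 | h4
    · exact h1 ⟨hx.1, h4⟩
    · exact h2 ⟨h4, hx.2⟩

/-- Absence of alternations gives a sign pattern, possibly with fewer sign changes. -/
lemma NoAlternation.signPattern {k : ℕ} {D : ℝ → ℝ} {a : ℝ} (h : NoAlternation k D a) :
    SignPattern k D a ∨ ∃ m < k, SignPattern m D a ∨ SignPattern m (-D) a := by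
  induction k generalizing D a with
  | zero => exact Or.inl (Filter.Eventually.of_forall h)
  | succ k ih =>
    by_cases hA : ∃ x, a < x ∧ D x < 0
    · set A := {x | a < x ∧ D x < 0} with hAdef
      have hAne : A.Nonempty := hA
      have hbdd : BddBelow A := ⟨a, fun x hx => hx.1.le⟩
      -- The first block ends where D first becomes negative. Points of `A` accumulate at s from the
      -- right or s itself is in `A`, so every x > s has a point of `A` before it and one
      -- alternation is used up.
      set s := sInf A with hs
      have has : a ≤ s := le_csInf hAne fun x hx => hx.1.le
      have hlt : ∀ x ∈ Ioo a s, 0 ≤ D x := fun x hx => by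
        by_contra hc
        exact absurd (csInf_le hbdd ⟨hx.1, not_le.1 hc⟩) (not_le.2 hx.2)
      have hN : NoAlternation k (-D) s := by
        cases k with
        | zero =>
          intro x hx
          obtain ⟨y, hy, hyx⟩ := exists_lt_of_csInf_lt hAne hx
          exact h y hy.1 hy.2 x hyx
        | succ k =>
          intro x hx
          obtain ⟨y, hy, hyx⟩ := exists_lt_of_csInf_lt hAne hx
          exact h y hy.1 hy.2 x hyx
      have hae : ∀ᵐ x, x ∈ Ioo a s → 0 ≤ D x := Filter.Eventually.of_forall hlt
      -- If s = a the first block is empty and one sign change is lost. If the rest again starts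
      -- with D ≥ 0, it merges with the first block.
      rcases has.eq_or_lt with heq | has'
      · rw [← heq] at hN
        rcases ih hN with h1 | ⟨m, hm, h1 | h1⟩
        · exact Or.inr ⟨k, by omega, Or.inr h1⟩
        · exact Or.inr ⟨m, by omega, Or.inr h1⟩
        · exact Or.inr ⟨m, by omega, Or.inl (by simpa using h1)⟩
      · rcases ih hN with h1 | ⟨m, hm, h1 | h1⟩
        · exact Or.inl ⟨s, has', hae, h1⟩
        · exact Or.inr ⟨m + 1, by omega, Or.inl ⟨s, has', hae, h1⟩⟩
        · rw [neg_neg] at h1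
          exact Or.inr ⟨m, by omega, Or.inl (h1.extend has hae)⟩
    · push Not at hA
      exact Or.inr ⟨0, by omega, Or.inl (Filter.Eventually.of_forall hA)⟩

/-! ### Even functions with vanishing moments -/

/-- `D` is even and its moments of orders `0`, `2` and `p` exist and vanish. -/
structure VanishingMoments (p : ℝ) (D : ℝ → ℝ) : Prop where
  even : ∀ x, D (-x) = D x
  int_zero : Integrable D
  int_two : Integrable fun x => x ^ 2 * D x
  int_p : Integrable fun x => |x| ^ p * D x
  zero : ∫ x, D x = 0
  two : ∫ x, x ^ 2 * D x = 0
  pth : ∫ x, |x| ^ p * D x = 0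

lemma VanishingMoments.neg {p : ℝ} {D : ℝ → ℝ} (h : VanishingMoments p D) :
    VanishingMoments p (-D) where
  even x := by simp [h.even]
  int_zero := h.int_zero.neg
  int_two := by simpa using h.int_two.neg
  int_p := by simpa using h.int_p.neg
  zero := by simp [integral_neg, h.zero]
  two := by simp [integral_neg, h.two]
  pth := by simp [integral_neg, h.pth]

lemma VanishingMoments.integrable_combination {p : ℝ} {D : ℝ → ℝ} (h : VanishingMoments p D)
    (c₀ c₁ c₂ : ℝ) : Integrable fun x => (c₀ + c₁ * |x| ^ 2 + c₂ * |x| ^ p) * D x := by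
  refine (((h.int_zero.const_mul c₀).add (h.int_two.const_mul c₁)).add
    (h.int_p.const_mul c₂)).congr (Filter.Eventually.of_forall fun x => ?_)
  simp only [Pi.add_apply, sq_abs]
  ring

lemma VanishingMoments.integral_combination {p : ℝ} {D : ℝ → ℝ} (h : VanishingMoments p D)
    (c₀ c₁ c₂ : ℝ) : ∫ x, (c₀ + c₁ * |x| ^ 2 + c₂ * |x| ^ p) * D x = 0 := by
  have : ∀ x, (c₀ + c₁ * |x| ^ 2 + c₂ * |x| ^ p) * D x
      = c₀ * D x + c₁ * (x ^ 2 * D x) + c₂ * (|x| ^ p * D x) := fun x => by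
    rw [sq_abs]; ring
  have hi : Integrable fun x => c₀ * D x + c₁ * (x ^ 2 * D x) :=
    (h.int_zero.const_mul c₀).add (h.int_two.const_mul c₁)
  simp only [this]
  rw [integral_add hi (h.int_p.const_mul c₂),
    integral_add (h.int_zero.const_mul c₀) (h.int_two.const_mul c₁), integral_const_mul,
    integral_const_mul, integral_const_mul, h.zero, h.two, h.pth]
  simp

lemma abs_add_rpow_le {p : ℝ} (hp : 0 ≤ p) (x s : ℝ) :
    |x + s| ^ p ≤ 2 ^ p * |x| ^ p + 2 ^ p * |s| ^ p := by
  have h1 : |x + s| ≤ 2 * max |x| |s| := by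
    have := abs_add_le x s
    have := le_max_left |x| |s|
    have := le_max_right |x| |s|
    linarith
  have h2 : |x + s| ^ p ≤ 2 ^ p * (max |x| |s|) ^ p := by
    rw [← Real.mul_rpow (by norm_num) (by positivity)]
    exact Real.rpow_le_rpow (abs_nonneg _) h1 hp
  refine h2.trans ?_
  rw [← mul_add]
  gcongr
  rcases max_cases |x| |s| with h | h
  · rw [h.1]; have : 0 ≤ |s| ^ p := by positivity
    linarith
  · rw [h.1]; have : 0 ≤ |x| ^ p := by positivity
    linarith

/-- Integrability of shifted powers from that of centred ones. -/
lemma integrable_shift_rpow_mul {p : ℝ} (hp : 0 ≤ p) {D : ℝ → ℝ} (h0 : Integrable D)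
    (hD : Integrable fun x => |x| ^ p * D x) (s : ℝ) : Integrable fun x => |x + s| ^ p * D x := by
  have hm : Measurable fun x : ℝ => |x + s| ^ p := by fun_prop
  refine Integrable.mono' ((hD.norm.const_mul (2 ^ p)).add (h0.norm.const_mul (2 ^ p * |s| ^ p)))
    (hm.aestronglyMeasurable.mul h0.aestronglyMeasurable)
    (Filter.Eventually.of_forall fun x => ?_)
  have h1 := abs_add_rpow_le hp x s
  have h2 : 0 ≤ |x + s| ^ p := by positivity
  have h3 : 0 ≤ |x| ^ p := by positivity
  simp only [Pi.add_apply, norm_mul, Real.norm_eq_abs, abs_of_nonneg h2, abs_of_nonneg h3]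
  have := mul_le_mul_of_nonneg_right h1 (abs_nonneg (D x))
  linarith

lemma ae_abs_of_ae_pos {P : ℝ → Prop} (h : ∀ᵐ x : ℝ, 0 < x → P x) : ∀ᵐ x : ℝ, P |x| := by
  have h2 := (Measure.measurePreserving_neg (volume : Measure ℝ)).quasiMeasurePreserving.ae h
  filter_upwards [h, h2, Measure.ae_ne volume (0 : ℝ)] with x h1 h2 h3
  rcases lt_or_gt_of_ne h3 with h4 | h4
  · rw [abs_of_neg h4]; exact h2 (by simpa using h4)
  · rw [abs_of_pos h4]; exact h1 h4

lemma eq_abs_of_even {D : ℝ → ℝ} (h : ∀ x, D (-x) = D x) (x : ℝ) : D |x| = D x := by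
  rcases abs_choice x with hx | hx <;> rw [hx]
  exact h x

/-- A weight that has the sign of `D` tests positively against `D`, strictly unless `D` vanishes. -/
lemma integral_nonneg_of_signs {D w : ℝ → ℝ} (hD : ∀ x, D (-x) = D x)
    (hint : Integrable fun x => w |x| * D x) (hw : ∀ᵐ x, 0 < x → 0 ≤ w x * D x)
    (hw0 : ∀ᵐ x, 0 < x → w x ≠ 0) :
    0 ≤ ∫ x, w |x| * D x ∧ (∫ x, w |x| * D x = 0 → D =ᵐ[volume] 0) := by
  have h1 : 0 ≤ᵐ[volume] fun x => w |x| * D x := by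
    filter_upwards [ae_abs_of_ae_pos hw] with x hx
    rwa [eq_abs_of_even hD] at hx
  refine ⟨integral_nonneg_of_ae h1, fun h => ?_⟩
  rw [integral_eq_zero_iff_of_nonneg_ae h1 hint] at h
  filter_upwards [h, ae_abs_of_ae_pos hw0] with x h2 h3
  simpa [h3] using h2

/-- An even function with at most two sign changes whose moments vanish is zero. -/
lemma VanishingMoments.eq_zero_of_signPattern {p : ℝ} (hp : 4 < p) {D : ℝ → ℝ}
    (h : VanishingMoments p D) {m : ℕ} (hm : m < 3) (hpat : SignPattern m D 0) :
    D =ᵐ[volume] 0 := by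
  -- A combination of 1, x², x^p with the signs of D makes w D a nonnegative function of integral 0.
  -- For 0, 1, 2 sign changes the choices are 1, s² - x², and the two-point interpolation error.
  suffices H : ∃ c₀ c₁ c₂ : ℝ, ∃ w : ℝ → ℝ, w = (fun x => c₀ + c₁ * x ^ 2 + c₂ * x ^ p) ∧
      (∀ᵐ x, 0 < x → 0 ≤ w x * D x) ∧ (∀ᵐ x, 0 < x → w x ≠ 0) by
    obtain ⟨c₀, c₁, c₂, w, rfl, h1, h2⟩ := H
    exact (integral_nonneg_of_signs h.even (h.integrable_combination c₀ c₁ c₂) h1 h2).2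
      (h.integral_combination c₀ c₁ c₂)
  interval_cases m
  · refine ⟨1, 0, 0, _, rfl, ?_, by simp⟩
    simpa [SignPattern] using hpat
  · obtain ⟨s, hs, h1, h2⟩ := hpat
    refine ⟨s ^ 2, -1, 0, _, rfl, ?_, ?_⟩
    · filter_upwards [h1, h2, Measure.ae_ne volume s] with x h1 h2 h3 hx
      simp only [Pi.neg_apply] at h2
      rcases lt_or_gt_of_ne h3 with h4 | h4
      · exact mul_nonneg (by nlinarith) (h1 ⟨hx, h4⟩)
      · exact mul_nonneg_of_nonpos_of_nonpos (by nlinarith) (by linarith [h2 h4])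
    · filter_upwards [Measure.ae_ne volume s] with x h3 hx h0
      have : (s - x) * (s + x) = 0 := by linear_combination h0
      rcases mul_eq_zero.1 this with h | h
      · exact h3 (by linarith)
      · linarith
  · obtain ⟨s, hs, h1, t, hst, h2, h4⟩ := hpat
    obtain ⟨c₀, c₁, hc⟩ := exists_two_point_power hp hs hst
    obtain ⟨-, -, w1, w2, w3⟩ := hc _ rfl
    refine ⟨c₀, c₁, 1, _, rfl, ?_, ?_⟩
    · filter_upwards [h1, h2, h4, Measure.ae_ne volume s, Measure.ae_ne volume t]
        with x h1 h2 h4 h5 h6 hx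
      simp only [Pi.neg_apply, neg_neg] at h2 h4
      rcases lt_or_gt_of_ne h5 with h7 | h7
      · exact mul_nonneg (w1 x ⟨hx, h7⟩).le (h1 ⟨hx, h7⟩)
      · rcases lt_or_gt_of_ne h6 with h8 | h8
        · exact mul_nonneg_of_nonpos_of_nonpos (w2 x ⟨h7, h8⟩).le (by linarith [h2 ⟨h7, h8⟩])
        · exact mul_nonneg (w3 x h8).le (h4 h8)
    · filter_upwards [Measure.ae_ne volume s, Measure.ae_ne volume t] with x h5 h6 hx
      rcases lt_or_gt_of_ne h5 with h7 | h7
      · exact (w1 x ⟨hx, h7⟩).ne'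
      · rcases lt_or_gt_of_ne h6 with h8 | h8
        · exact (w2 x ⟨h7, h8⟩).ne
        · exact (w3 x h8).ne'

lemma symPow_abs (p s x : ℝ) : symPow p s |x| = symPow p s x := by
  rcases abs_choice x with hx | hx <;> rw [hx]
  unfold symPow
  rw [← abs_neg (-x + s), ← abs_neg (-x - s), add_comm]
  ring_nf

lemma VanishingMoments.integrable_symPow {p : ℝ} (hp : 4 < p) {D : ℝ → ℝ}
    (h : VanishingMoments p D) (s : ℝ) : Integrable fun x => symPow p s x * D x := by
  have h1 := integrable_shift_rpow_mul (by linarith) h.int_zero h.int_p s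
  have h2 := integrable_shift_rpow_mul (by linarith) h.int_zero h.int_p (-s)
  refine (h1.add h2).congr (Filter.Eventually.of_forall fun x => ?_)
  simp only [symPow, Pi.add_apply, ← sub_eq_add_neg]
  ring

/-- The key comparison: vanishing moments and at most three sign changes `+, -, +, -` make the
integral against `symPow p s` non-negative, and positive unless the function vanishes. -/
lemma VanishingMoments.integral_symPow_nonneg {p : ℝ} (hp : 4 < p) {D : ℝ → ℝ}
    (h : VanishingMoments p D) (hN : NoAlternation 3 D 0) {s : ℝ} (hs : 0 < s) :
    0 ≤ ∫ x, symPow p s x * D x ∧ (∫ x, symPow p s x * D x = 0 → D =ᵐ[volume] 0) := by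
  rcases hN.signPattern with hpat | ⟨m, hm, hpat⟩
  · obtain ⟨x₁, h01, h1, x₂, h12, h2, x₃, h23, h3, h4⟩ := hpat
    obtain ⟨c₀, c₁, c₂, hc⟩ := exists_three_point_symPow hp hs h01 h12 h23
    obtain ⟨w1, w2, w3, w4⟩ := hc _ rfl
    set w : ℝ → ℝ := fun x => symPow p s x + (c₀ + c₁ * x ^ 2 + c₂ * x ^ p) with hw
    have hws : ∀ x, w |x| * D x
        = symPow p s x * D x + (c₀ + c₁ * |x| ^ 2 + c₂ * |x| ^ p) * D x := fun x => by
      simp only [hw, symPow_abs]; ring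
    have hi := (h.integrable_symPow hp s).add (h.integrable_combination c₀ c₁ c₂)
    -- The interpolant is orthogonal to D, so `symPow` may be replaced by the interpolation error.
    have key : ∫ x, w |x| * D x = ∫ x, symPow p s x * D x := by
      simp only [hws]
      rw [integral_add (h.integrable_symPow hp s) (h.integrable_combination c₀ c₁ c₂),
        h.integral_combination, add_zero]
    rw [← key]
    refine integral_nonneg_of_signs h.even (hi.congr (Filter.Eventually.of_forall fun x =>
      (hws x).symm)) ?_ ?_
    · filter_upwards [h1, h2, h3, h4, Measure.ae_ne volume x₁, Measure.ae_ne volume x₂,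
        Measure.ae_ne volume x₃] with x h1 h2 h3 h4 n1 n2 n3 hx
      simp only [Pi.neg_apply, neg_neg] at h2 h3 h4
      rcases lt_or_gt_of_ne n1 with l1 | l1
      · exact mul_nonneg (w1 x ⟨hx, l1⟩).le (h1 ⟨hx, l1⟩)
      rcases lt_or_gt_of_ne n2 with l2 | l2
      · exact mul_nonneg_of_nonpos_of_nonpos (w2 x ⟨l1, l2⟩).le (by linarith [h2 ⟨l1, l2⟩])
      rcases lt_or_gt_of_ne n3 with l3 | l3
      · exact mul_nonneg (w3 x ⟨l2, l3⟩).le (h3 ⟨l2, l3⟩)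
      · exact mul_nonneg_of_nonpos_of_nonpos (w4 x l3).le (by linarith [h4 l3])
    · filter_upwards [Measure.ae_ne volume x₁, Measure.ae_ne volume x₂,
        Measure.ae_ne volume x₃] with x n1 n2 n3 hx
      rcases lt_or_gt_of_ne n1 with l1 | l1
      · exact (w1 x ⟨hx, l1⟩).ne'
      rcases lt_or_gt_of_ne n2 with l2 | l2
      · exact (w2 x ⟨l1, l2⟩).ne
      rcases lt_or_gt_of_ne n3 with l3 | l3
      · exact (w3 x ⟨l2, l3⟩).ne'
      · exact (w4 x l3).ne
  · have h0 : D =ᵐ[volume] 0 := by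
      rcases hpat with h1 | h1
      · exact h.eq_zero_of_signPattern hp hm h1
      · filter_upwards [h.neg.eq_zero_of_signPattern hp hm h1] with x hx
        simpa using hx
    refine ⟨le_of_eq ?_, fun _ => h0⟩
    symm
    apply integral_eq_zero_of_ae
    filter_upwards [h0] with x hx
    simp [hx]

/-- For even `D` the two halves of `symPow` contribute equally. -/
lemma VanishingMoments.integral_symPow_eq {p : ℝ} (hp : 4 < p) {D : ℝ → ℝ}
    (h : VanishingMoments p D) (s : ℝ) :
    ∫ x, symPow p s x * D x = 2 * ∫ x, |x + s| ^ p * D x := by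
  have h1 := integrable_shift_rpow_mul (by linarith) h.int_zero h.int_p s
  have h2 := integrable_shift_rpow_mul (by linarith) h.int_zero h.int_p (-s)
  have e : ∫ x, |x + -s| ^ p * D x = ∫ x, |x + s| ^ p * D x := by
    rw [← integral_neg_eq_self]
    congr 1 with x
    rw [h.even, ← abs_neg (-x + -s)]
    ring_nf
  have : ∀ x, symPow p s x * D x = |x + s| ^ p * D x + |x + -s| ^ p * D x := fun x => by
    simp only [symPow, ← sub_eq_add_neg]; ring
  simp only [this]
  rw [integral_add h1 h2, e]; ring

/-- The comparison of shifted `p`-th moments. -/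
lemma VanishingMoments.integral_shift_nonneg {p : ℝ} (hp : 4 < p) {D : ℝ → ℝ}
    (h : VanishingMoments p D) (hN : NoAlternation 3 D 0) (s : ℝ) :
    0 ≤ ∫ x, |x + s| ^ p * D x := by
  rcases lt_trichotomy s 0 with hs | rfl | hs
  · have h1 := (h.integral_symPow_nonneg hp hN (neg_pos.2 hs)).1
    have e : symPow p (-s) = symPow p s := by
      ext x; simp [symPow, sub_eq_add_neg, add_comm]
    rw [e, h.integral_symPow_eq hp] at h1
    linarith
  · simp [h.pth]
  · have h1 := (h.integral_symPow_nonneg hp hN hs).1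
    rw [h.integral_symPow_eq hp] at h1
    linarith

/-- If neither `D` nor `-D` has the forbidden alternation, then `D` vanishes. -/
lemma VanishingMoments.eq_zero {p : ℝ} (hp : 4 < p) {D : ℝ → ℝ} (h : VanishingMoments p D)
    (hN : NoAlternation 3 D 0) (hN' : NoAlternation 3 (-D) 0) : D =ᵐ[volume] 0 := by
  have h1 := h.integral_symPow_nonneg hp hN one_pos
  have h2 := h.neg.integral_symPow_nonneg hp hN' one_pos
  simp only [Pi.neg_apply, mul_neg, integral_neg] at h2
  exact h1.2 (le_antisymm (by linarith [h2.1]) h1.1)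

/-! ### Even log-concave functions -/

/-- Even functions that are log-concave, stated as a multiplicative inequality. -/
structure IsEvenLogConcave (f : ℝ → ℝ) : Prop where
  nonneg : ∀ x, 0 ≤ f x
  even : ∀ x, f (-x) = f x
  rpow_mul_le : ∀ x y t, 0 < t → t < 1 → 0 < f x → 0 < f y →
    f x ^ t * f y ^ (1 - t) ≤ f (t * x + (1 - t) * y)

/-- For 0 ≤ x ≤ y the point x is a convex combination of y and -y, where f takes the same value. -/
lemma IsEvenLogConcave.antitoneOn {f : ℝ → ℝ} (hf : IsEvenLogConcave f) {x y : ℝ} (hx : 0 ≤ x)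
    (hxy : x ≤ y) : f y ≤ f x := by
  rcases hxy.eq_or_lt with rfl | hxy
  · exact le_rfl
  rcases (hf.nonneg y).eq_or_lt with h0 | h0
  · rw [← h0]; exact hf.nonneg x
  have hy : 0 < y := hx.trans_lt hxy
  have h := hf.rpow_mul_le y (-y) ((x + y) / (2 * y)) (by positivity)
    (by rw [div_lt_one (by positivity)]; linarith) h0 (by rwa [hf.even])
  rw [hf.even, ← Real.rpow_add h0, add_sub_cancel, Real.rpow_one] at h
  convert h using 2
  field_simp
  ring

lemma exists_convex_combination {x y z : ℝ} (hxy : x < y) (hyz : y < z) :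
    ∃ t, 0 < t ∧ t < 1 ∧ y = t * x + (1 - t) * z := by
  refine ⟨(z - y) / (z - x), div_pos (by linarith) (by linarith), ?_, ?_⟩
  · rw [div_lt_one (by linarith)]; linarith
  · have : z - x ≠ 0 := by linarith
    field_simp
    ring

/-- A log-concave function that is above a log-convex one at the endpoints of an interval is not
below it inside. -/
lemma IsEvenLogConcave.not_lt_of_logConvex {f g : ℝ → ℝ} (hf : IsEvenLogConcave f)
    {x y z : ℝ} (hxy : x < y) (hyz : y < z) (hgx : 0 ≤ g x) (hgz : 0 ≤ g z)
    (hg : ∀ t, 0 < t → t < 1 → g (t * x + (1 - t) * z) ≤ g x ^ t * g z ^ (1 - t))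
    (hx : g x < f x) (hy : f y < g y) (hz : g z < f z) : False := by
  obtain ⟨t, h0, h1, rfl⟩ := exists_convex_combination hxy hyz
  have a := hg t h0 h1
  have b := hf.rpow_mul_le x z t h0 h1 (hgx.trans_lt hx) (hgz.trans_lt hz)
  have c : g x ^ t * g z ^ (1 - t) ≤ f x ^ t * f z ^ (1 - t) := by
    have := Real.rpow_le_rpow hgx hx.le h0.le
    have := Real.rpow_le_rpow hgz hz.le (show 0 ≤ 1 - t by linarith)
    have := hf.nonneg x
    gcongr
  linarith

/-- `g` is constant on `(0, α]` and log-convex on `(α, ∞)`. -/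
structure IsFlatThenLogConvex (g : ℝ → ℝ) (α : ℝ) : Prop where
  nonneg : ∀ x, 0 ≤ g x
  flat : ∀ x y, 0 < x → x < y → y ≤ α → g x = g y
  le_rpow_mul : ∀ x y t, α < x → α < y → 0 < t → t < 1 →
    g (t * x + (1 - t) * y) ≤ g x ^ t * g y ^ (1 - t)

/-- `g` is log-convex on each interval `(0, z]` with `g z > 0`. -/
structure IsLogConvexOnSupport (g : ℝ → ℝ) : Prop where
  nonneg : ∀ x, 0 ≤ g x
  le_rpow_mul : ∀ x y z t, 0 < x → x < y → y < z → 0 < g z → 0 < t → t < 1 →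
    g (t * x + (1 - t) * y) ≤ g x ^ t * g y ^ (1 - t)

/-- Suppose f - g has signs -, +, -, + at x₁ < x₂ < x₃ < x₄. If x₂ ≤ α, then g(x₁) = g(x₂) makes f
increase from x₁ to x₂. Otherwise g is log-convex on [x₂, x₄], where f is above, below, above. -/
lemma IsEvenLogConcave.noAlternation_sub_flat {f g : ℝ → ℝ} (hf : IsEvenLogConcave f) {α : ℝ}
    (hg : IsFlatThenLogConvex g α) : NoAlternation 3 (f - g) 0 := by
  intro x₁ h01 d1 x₂ h12 d2 x₃ h23 d3 x₄ h34
  simp only [Pi.sub_apply, Pi.neg_apply] at *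
  by_contra d4
  rcases le_or_gt x₂ α with h | h
  · have e := hg.flat x₁ x₂ h01 h12 h
    have := hf.antitoneOn h01.le h12.le
    linarith
  · exact hf.not_lt_of_logConvex (g := g) h23 h34 (hg.nonneg _) (hg.nonneg _)
      (fun t h0 h1 => hg.le_rpow_mul _ _ t h (h.trans (h23.trans h34)) h0 h1)
      (by linarith) (by linarith) (by linarith)

/-- The last sign + gives g(x₄) > f(x₄) ≥ 0, so g is log-convex up to x₄. At x₁, x₂, x₃ the
log-concave f would be above, below, above it. -/
lemma IsEvenLogConcave.noAlternation_logConvex_sub {f g : ℝ → ℝ} (hf : IsEvenLogConcave f)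
    (hg : IsLogConvexOnSupport g) : NoAlternation 3 (g - f) 0 := by
  intro x₁ h01 d1 x₂ h12 d2 x₃ h23 d3 x₄ h34
  simp only [Pi.sub_apply, Pi.neg_apply] at *
  by_contra d4
  have h4 : 0 < g x₄ := by linarith [hf.nonneg x₄]
  exact hf.not_lt_of_logConvex (g := g) h12 h23 (hg.nonneg _) (hg.nonneg _)
      (fun t h0 h1 => hg.le_rpow_mul _ _ _ t h01 (h12.trans h23) h34 h4 h0 h1)
      (by linarith) (by linarith) (by linarith)

lemma isEvenLogConcave_of_indicator {K : Set ℝ} {φ : ℝ → ℝ} (hφ : ConvexOn ℝ K φ)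
    (hK : ∀ x, -x ∈ K ↔ x ∈ K) (he : ∀ x, φ (-x) = φ x) :
    IsEvenLogConcave (K.indicator fun x => Real.exp (-φ x)) where
  nonneg x := indicator_nonneg (fun _ _ => (Real.exp_pos _).le) x
  even x := by
    by_cases hx : x ∈ K
    · rw [indicator_of_mem hx, indicator_of_mem ((hK x).2 hx), he]
    · rw [indicator_of_notMem hx, indicator_of_notMem (fun h => hx ((hK x).1 h))]
  rpow_mul_le x y t h0 h1 hx hy := by
    have hxK : x ∈ K := by by_contra h; simp [indicator_of_notMem h] at hx
    have hyK : y ∈ K := by by_contra h; simp [indicator_of_notMem h] at hy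
    have hz : t * x + (1 - t) * y ∈ K :=
      hφ.1 hxK hyK h0.le (by linarith) (by ring)
    rw [indicator_of_mem hxK, indicator_of_mem hyK, indicator_of_mem hz, ← Real.exp_mul,
      ← Real.exp_mul, ← Real.exp_add, Real.exp_le_exp]
    have := hφ.2 hxK hyK h0.le (show 0 ≤ 1 - t by linarith) (by ring)
    simp only [smul_eq_mul] at this
    linarith

/-- Convexity makes φ continuous inside K, and the frontier of a convex set is null. -/
lemma IsLogConcaveDensity.aemeasurable {f : ℝ → ℝ} (hf : IsLogConcaveDensity f) :
    AEMeasurable f := by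
  obtain ⟨K, φ, hφ, rfl⟩ := hf
  have hc : ContinuousOn (fun x => Real.exp (-φ x)) (interior K) :=
    Real.continuous_exp.comp_continuousOn hφ.continuousOn_interior.neg
  have h1 : AEMeasurable ((interior K).indicator fun x => Real.exp (-φ x)) :=
    (aemeasurable_indicator_iff isOpen_interior.measurableSet).2
      (hc.aemeasurable isOpen_interior.measurableSet)
  refine h1.congr ?_
  have hnull : ∀ᵐ x, x ∉ frontier K := by
    rw [ae_iff]; simpa using hφ.1.addHaar_frontier volume
  filter_upwards [hnull] with x hx
  by_cases hxi : x ∈ interior K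
  · rw [indicator_of_mem hxi, indicator_of_mem (interior_subset hxi)]
  · have : x ∉ K := fun h => hx ⟨subset_closure h, hxi⟩
    rw [indicator_of_notMem hxi, indicator_of_notMem this]

lemma IsLogConcaveDensity.nonneg {f : ℝ → ℝ} (hf : IsLogConcaveDensity f) (x : ℝ) : 0 ≤ f x := by
  obtain ⟨K, φ, hφ, rfl⟩ := hf
  exact indicator_nonneg (fun _ _ => (Real.exp_pos _).le) x

/-- An almost everywhere even log-concave density agrees almost everywhere with an even one. -/
lemma IsLogConcaveDensity.exists_even {f : ℝ → ℝ} (hf : IsLogConcaveDensity f)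
    (he : ∀ᵐ x, f (-x) = f x) : ∃ g, IsEvenLogConcave g ∧ g =ᵐ[volume] f := by
  obtain ⟨K, φ, hφ, rfl⟩ := hf
  have hφn : ConvexOn ℝ (-K) (fun x => φ (-x)) := by
    have := hφ.comp_linearMap (-LinearMap.id : ℝ →ₗ[ℝ] ℝ)
    exact this
  -- Averaging φ(x) and φ(-x) on K ∩ -K gives an even convex potential, and changes nothing at
  -- points where f(-x) = f(x).
  have hψ : ConvexOn ℝ (K ∩ -K) (fun x => (1 / 2 : ℝ) • (φ x + φ (-x))) :=
    ((hφ.subset inter_subset_left (hφ.1.inter hφn.1)).add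
      (hφn.subset inter_subset_right (hφ.1.inter hφn.1))).smul (by norm_num)
  refine ⟨_, isEvenLogConcave_of_indicator hψ (fun x => ?_) (fun x => ?_), ?_⟩
  · simp [and_comm]
  · simp [add_comm]
  · filter_upwards [he] with x hx
    by_cases h1 : x ∈ K
    · have h2 : -x ∈ K := by
        by_contra h2
        rw [indicator_of_mem h1, indicator_of_notMem h2] at hx
        exact (Real.exp_pos _).ne hx
      rw [indicator_of_mem h1, indicator_of_mem h2, Real.exp_eq_exp] at hx
      rw [indicator_of_mem h1, indicator_of_mem (show x ∈ K ∩ -K from ⟨h1, h2⟩), Real.exp_eq_exp, smul_eq_mul]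
      linarith
    · rw [indicator_of_notMem h1, indicator_of_notMem fun h => h1 h.1]

/-! ### Densities with closed support -/

/-- `f = exp (-φ)` on a closed symmetric interval with non-empty interior and `f = 0` elsewhere,
where `φ` is even, convex and continuous. -/
def IsClosedLogConcave (f : ℝ → ℝ) : Prop :=
  ∃ (K : Set ℝ) (φ : ℝ → ℝ), IsClosed K ∧ (interior K).Nonempty ∧ ConvexOn ℝ K φ ∧ Continuous φ ∧
    (∀ x, -x ∈ K ↔ x ∈ K) ∧ (∀ x, φ (-x) = φ x) ∧ f = K.indicator fun x => Real.exp (-φ x)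

lemma IsClosedLogConcave.isLogConcaveDensity {f : ℝ → ℝ} (hf : IsClosedLogConcave f) :
    IsLogConcaveDensity f := by
  obtain ⟨K, φ, -, -, h, -, -, -, rfl⟩ := hf
  exact ⟨K, φ, h, rfl⟩

lemma IsClosedLogConcave.isEvenLogConcave {f : ℝ → ℝ} (hf : IsClosedLogConcave f) :
    IsEvenLogConcave f := by
  obtain ⟨K, φ, -, -, h, -, h1, h2, rfl⟩ := hf
  exact isEvenLogConcave_of_indicator h h1 h2

/-- Almost everywhere equality of such densities forces equality. -/
lemma IsClosedLogConcave.eq_of_ae_eq {f g : ℝ → ℝ} (hf : IsClosedLogConcave f)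
    (hg : IsClosedLogConcave g) (h : f =ᵐ[volume] g) : f = g := by
  have dense : ∀ U : Set ℝ, IsOpen U → U.Nonempty → ∃ x ∈ U, f x = g x := by
    intro U hU hne
    by_contra hc
    push Not at hc
    have : volume U = 0 := measure_mono_null (fun x hx => hc x hx) (ae_iff.1 h)
    exact (hU.measure_pos volume hne).ne' this
  obtain ⟨K, φ, hK, hKi, hφ, hφc, -, -, rfl⟩ := hf
  obtain ⟨L, ψ, hL, hLi, hψ, hψc, -, -, rfl⟩ := hg
  -- A point of K outside L would thus have interior points of K near it, still outside L. There f >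
  -- 0 = g on a non-empty open set, against `dense`.
  have cK : closure (interior K) = K := by
    rw [hφ.1.closure_interior_eq_closure_of_nonempty_interior hKi, hK.closure_eq]
  have cL : closure (interior L) = L := by
    rw [hψ.1.closure_interior_eq_closure_of_nonempty_interior hLi, hL.closure_eq]
  have hKL : K ⊆ L := by
    intro x hx
    by_contra hxL
    rw [← cK, mem_closure_iff] at hx
    obtain ⟨y, ⟨hy1, hy2⟩, hy⟩ := dense (Lᶜ ∩ interior K) (hL.isOpen_compl.inter isOpen_interior)
      (hx _ hL.isOpen_compl hxL)
    rw [indicator_of_mem (interior_subset hy2), indicator_of_notMem hy1] at hy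
    exact (Real.exp_pos _).ne' hy
  have hLK : L ⊆ K := by
    intro x hx
    by_contra hxL
    rw [← cL, mem_closure_iff] at hx
    obtain ⟨y, ⟨hy1, hy2⟩, hy⟩ := dense (Kᶜ ∩ interior L) (hK.isOpen_compl.inter isOpen_interior)
      (hx _ hK.isOpen_compl hxL)
    rw [indicator_of_mem (interior_subset hy2), indicator_of_notMem hy1] at hy
    exact (Real.exp_pos _).ne hy
  obtain rfl : K = L := hKL.antisymm hLK
  ext x
  by_cases hx : x ∈ K
  · rw [indicator_of_mem hx, indicator_of_mem hx]
    by_contra hne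
    have ho : IsOpen {y | Real.exp (-φ y) ≠ Real.exp (-ψ y)} :=
      isOpen_ne_fun (by fun_prop) (by fun_prop)
    have hx' := hx
    rw [← cK, mem_closure_iff] at hx'
    obtain ⟨y, ⟨hy1, hy2⟩, hy⟩ := dense _ (ho.inter isOpen_interior) (hx' _ ho hne)
    rw [indicator_of_mem (interior_subset hy2), indicator_of_mem (interior_subset hy2)] at hy
    exact hy1 hy
  · rw [indicator_of_notMem hx, indicator_of_notMem hx]

/-! ### The two families -/

lemma uniformDensity_eq_indicator {α : ℝ} (hα : 0 < α) :
    uniformDensity α = (Icc (-α) α).indicator fun _ => Real.exp (-Real.log (2 * α)) := by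
  ext x
  rw [Real.exp_neg, Real.exp_log (by positivity)]
  simp only [uniformDensity, indicator, mem_Icc, ← abs_le, one_div]

lemma isClosedLogConcave_of_Icc {α : ℝ} (hα : 0 < α) {φ : ℝ → ℝ} (h1 : ConvexOn ℝ univ φ)
    (h2 : Continuous φ) (h3 : ∀ x, φ (-x) = φ x) :
    IsClosedLogConcave ((Icc (-α) α).indicator fun x => Real.exp (-φ x)) := by
  refine ⟨Icc (-α) α, φ, isClosed_Icc, ?_, h1.subset (subset_univ _) (convex_Icc _ _), h2, ?_, h3,
    rfl⟩
  · rw [interior_Icc]; exact nonempty_Ioo.2 (by linarith)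
  · intro x
    simp only [mem_Icc, ← abs_le, abs_neg]

lemma isClosedLogConcave_exp {φ : ℝ → ℝ} (h1 : ConvexOn ℝ univ φ)
    (h2 : Continuous φ) (h3 : ∀ x, φ (-x) = φ x) :
    IsClosedLogConcave fun x => Real.exp (-φ x) :=
  ⟨univ, φ, isClosed_univ, by simp, h1, h2, by simp, h3, by simp⟩

lemma convexOn_mul_abs {c : ℝ} (hc : 0 ≤ c) (d : ℝ) : ConvexOn ℝ univ fun x : ℝ => c * |x| + d :=
  ((convexOn_univ_norm (E := ℝ)).smul hc).add_const d

lemma isClosedLogConcave_uniformDensity {α : ℝ} (hα : 0 < α) :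
    IsClosedLogConcave (uniformDensity α) := by
  rw [uniformDensity_eq_indicator hα]
  exact isClosedLogConcave_of_Icc hα (convexOn_const _ convex_univ) continuous_const fun _ => rfl

lemma isClosedLogConcave_of_mem_familyMinus {f : ℝ → ℝ} (hf : f ∈ familyMinus) :
    IsClosedLogConcave f := by
  obtain ⟨α, γ, hα, hγ, hαγ, rfl⟩ := hf
  by_cases h : γ = ⊤
  · have : flatExpDensity α γ = uniformDensity α := by ext x; simp [flatExpDensity, h]
    rw [this]; exact isClosedLogConcave_uniformDensity (hαγ h)
  · have hg : 0 < γ.toReal := ENNReal.toReal_pos hγ.ne' h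
    have : flatExpDensity α γ = fun x => Real.exp (-(γ.toReal * max (|x| - α) 0
        + Real.log (2 * (α + 1 / γ.toReal)))) := by
      ext x
      rw [neg_add, Real.exp_add, Real.exp_neg (Real.log _), Real.exp_log (by positivity)]
      simp only [flatExpDensity, h, if_false]
      ring
    rw [this]
    refine isClosedLogConcave_exp ?_ (by fun_prop) (by simp)
    have h1 : ConvexOn ℝ univ fun x : ℝ => |x| - α := by
      simpa [sub_eq_add_neg] using convexOn_mul_abs zero_le_one (-α)
    exact ((h1.sup (convexOn_const 0 convex_univ)).smul hg.le).add_const _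

lemma isClosedLogConcave_of_mem_familyPlus {f : ℝ → ℝ} (hf : f ∈ familyPlus) :
    IsClosedLogConcave f := by
  obtain ⟨α, γ, hα, hγ, hαγ, rfl⟩ := hf
  rcases hγ.eq_or_lt with rfl | hγ
  · have : truncExpDensity α 0 = uniformDensity α.toReal := by ext x; simp [truncExpDensity]
    rw [this]
    refine isClosedLogConcave_uniformDensity (ENNReal.toReal_pos hα.ne' fun h => ?_)
    exact absurd (hαγ h) (lt_irrefl _)
  by_cases h : α = ⊤
  · have : truncExpDensity α γ = fun x => Real.exp (-(γ * |x| + -Real.log (γ / 2))) := by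
      ext x
      rw [neg_add, Real.exp_add, neg_neg, Real.exp_log (by positivity)]
      simp only [truncExpDensity, hγ.ne', h, if_false, if_true]
      ring
    rw [this]
    exact isClosedLogConcave_exp (convexOn_mul_abs hγ.le _) (by fun_prop) (by simp)
  · have ha : 0 < α.toReal := ENNReal.toReal_pos hα.ne' h
    have hc : 0 < γ / (2 * (1 - Real.exp (-(α.toReal * γ)))) := by
      have : Real.exp (-(α.toReal * γ)) < 1 := Real.exp_lt_one_iff.2 (by simpa using mul_pos ha hγ)
      apply div_pos hγ; linarith
    have : truncExpDensity α γ = (Icc (-α.toReal) α.toReal).indicator fun x =>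
        Real.exp (-(γ * |x| + -Real.log (γ / (2 * (1 - Real.exp (-(α.toReal * γ))))))) := by
      ext x
      simp only [truncExpDensity, hγ.ne', h, if_false, indicator, mem_Icc, ← abs_le]
      rw [neg_add, Real.exp_add, neg_neg, Real.exp_log hc]
      split_ifs <;> ring
    rw [this]
    exact isClosedLogConcave_of_Icc ha (convexOn_mul_abs hγ.le _) (by fun_prop) (by simp)

/-- A multiple of an exponential is log-affine, so log-convexity holds with equality wherever a
member of either family is a single exponential. -/
lemma mul_exp_combination {c : ℝ} (hc : 0 ≤ c) (γ x y t : ℝ) :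
    c * Real.exp (-(γ * (t * x + (1 - t) * y)))
      = (c * Real.exp (-(γ * x))) ^ t * (c * Real.exp (-(γ * y))) ^ (1 - t) := by
  rcases hc.eq_or_lt with rfl | hc
  · simp only [zero_mul]
    rcases eq_or_ne t 0 with rfl | ht
    · simp
    · simp [Real.zero_rpow ht]
  · rw [Real.mul_rpow hc.le (Real.exp_pos _).le, Real.mul_rpow hc.le (Real.exp_pos _).le,
      ← Real.exp_mul, ← Real.exp_mul]
    have : c = c ^ t * c ^ (1 - t) := by rw [← Real.rpow_add hc]; simp
    have e : Real.exp (-(γ * (t * x + (1 - t) * y)))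
        = Real.exp (-(γ * x) * t) * Real.exp (-(γ * y) * (1 - t)) := by
      rw [← Real.exp_add]; ring_nf
    rw [e]
    nth_rewrite 1 [this]
    ring

lemma isFlatThenLogConvex_of_mem_familyMinus {f : ℝ → ℝ} (hf : f ∈ familyMinus) :
    ∃ α, IsFlatThenLogConvex f α := by
  have hn := (isClosedLogConcave_of_mem_familyMinus hf).isLogConcaveDensity.nonneg
  obtain ⟨α, γ, hα, hγ, hαγ, rfl⟩ := hf
  refine ⟨α, hn, fun x y hx hxy hy => ?_, fun x y t hx hy h0 h1 => ?_⟩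
  · have hx' : |x| ≤ α := by rw [abs_of_pos hx]; linarith
    have hy' : |y| ≤ α := by rw [abs_of_pos (hx.trans hxy)]; linarith
    simp [flatExpDensity, uniformDensity, hx', hy']
  · have hz : α < t * x + (1 - t) * y := by nlinarith
    by_cases h : γ = ⊤
    · have hzero : flatExpDensity α γ (t * x + (1 - t) * y) = 0 := by
        simp only [flatExpDensity, h, if_true, uniformDensity]
        rw [if_neg (by rw [abs_of_pos (by linarith)]; linarith)]
      rw [hzero]
      exact mul_nonneg (Real.rpow_nonneg (hn _) _) (Real.rpow_nonneg (hn _) _)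
    · have hval : ∀ x, α < x → flatExpDensity α γ x =
          1 / (2 * (α + 1 / γ.toReal)) * Real.exp (γ.toReal * α) * Real.exp (-(γ.toReal * x)) := by
        intro x hx
        rw [mul_assoc, ← Real.exp_add]
        simp only [flatExpDensity, h, if_false, abs_of_pos (hα.trans_lt hx)]
        rw [max_eq_left (by linarith)]
        ring_nf
      rw [hval _ hx, hval _ hy, hval _ hz]
      exact (mul_exp_combination (by positivity) _ _ _ _).le

lemma isLogConvexOnSupport_of_mem_familyPlus {f : ℝ → ℝ} (hf : f ∈ familyPlus) :
    IsLogConvexOnSupport f := by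
  have hn := (isClosedLogConcave_of_mem_familyPlus hf).isLogConcaveDensity.nonneg
  obtain ⟨α, γ, hα, hγ, hαγ, rfl⟩ := hf
  refine ⟨hn, fun x y z t hx hxy hyz hz h0 h1 => ?_⟩
  -- Positivity of the density at z keeps (0, z] clear of the truncation, so a single exponential
  -- (constant if γ = 0) describes it there.
  obtain ⟨c, hc, hval⟩ : ∃ c, 0 ≤ c ∧ ∀ w, 0 < w → w ≤ z →
      truncExpDensity α γ w = c * Real.exp (-(γ * w)) := by
    have hz0 : 0 < z := hx.trans (hxy.trans hyz)
    rcases hγ.eq_or_lt with rfl | hγ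
    · refine ⟨1 / (2 * α.toReal), by positivity, fun w hw hwz => ?_⟩
      have : |z| ≤ α.toReal := by
        by_contra hc
        simp [truncExpDensity, uniformDensity, hc] at hz
      have hw' : |w| ≤ α.toReal := by
        rw [abs_of_pos hw]; rw [abs_of_pos hz0] at this; linarith
      simp [truncExpDensity, uniformDensity, hw']
    by_cases h : α = ⊤
    · refine ⟨γ / 2, by positivity, fun w hw hwz => ?_⟩
      simp [truncExpDensity, hγ.ne', h, abs_of_pos hw]
    · have : |z| ≤ α.toReal := by
        by_contra hc
        simp [truncExpDensity, hγ.ne', h, hc] at hz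
      have ha : Real.exp (-(α.toReal * γ)) ≤ 1 := Real.exp_le_one_iff.2 (by simp; positivity)
      refine ⟨γ / (2 * (1 - Real.exp (-(α.toReal * γ)))), ?_, fun w hw hwz => ?_⟩
      · apply div_nonneg hγ.le; linarith
      have hw' : |w| ≤ α.toReal := by
        rw [abs_of_pos hw]; rw [abs_of_pos hz0] at this; linarith
      rw [truncExpDensity, if_neg hγ.ne', if_neg h, if_pos hw', abs_of_pos hw]
  have hy : 0 < y := hx.trans hxy
  rw [hval x hx (by linarith), hval y hy (by linarith),
    hval _ (by nlinarith) (by nlinarith)]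
  exact (mul_exp_combination hc _ _ _ _).le

/-! ### Moments of the densities `f_{α,γ}` -/

lemma integrableOn_rpow_mul_exp_neg {k : ℝ} (hk : 0 ≤ k) :
    IntegrableOn (fun v : ℝ => v ^ k * Real.exp (-v)) (Ioi 0) := by
  refine (Real.GammaIntegral_convergent (s := k + 1) (by linarith)).congr_fun (fun v _ => ?_)
    measurableSet_Ioi
  simp only [add_sub_cancel_right]
  ring

lemma integral_rpow_mul_exp_neg {k : ℝ} (hk : 0 ≤ k) :
    ∫ v in Ioi (0 : ℝ), v ^ k * Real.exp (-v) = Real.Gamma (k + 1) := by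
  rw [Real.Gamma_eq_integral (by linarith)]
  refine setIntegral_congr_fun measurableSet_Ioi fun v _ => ?_
  simp only [add_sub_cancel_right]
  ring

/-- The bound is uniform in α, β ∈ [0, 1] and provides the dominating function for continuity in the
parameter. -/
lemma affine_rpow_le {k α β v : ℝ} (hk : 0 ≤ k) (hα : 0 ≤ α) (hβ : 0 ≤ β) (hv : 0 ≤ v)
    (hα1 : α ≤ 1) (hβ1 : β ≤ 1) :
    (α + β * v) ^ k ≤ 2 ^ k * v ^ k + 2 ^ k := by
  have h := abs_add_rpow_le hk v 1
  rw [abs_one, Real.one_rpow, mul_one, abs_of_nonneg hv, abs_of_nonneg (by linarith)] at h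
  refine le_trans (Real.rpow_le_rpow (by positivity) ?_ hk) h
  nlinarith

lemma integrableOn_affineBound {k : ℝ} (hk : 0 ≤ k) :
    IntegrableOn (fun v : ℝ => (2 ^ k * v ^ k + 2 ^ k) * Real.exp (-v)) (Ioi 0) := by
  have h1 := (integrableOn_rpow_mul_exp_neg hk).const_mul (2 ^ k)
  have h2 := (integrableOn_rpow_mul_exp_neg le_rfl).const_mul ((2 : ℝ) ^ k)
  refine (h1.add h2).congr (Filter.Eventually.of_forall fun v => ?_)
  simp only [Pi.add_apply, Real.rpow_zero]
  ring

lemma integrableOn_affine_rpow_mul_exp {k α β : ℝ} (hk : 0 ≤ k) (hα : 0 ≤ α) (hβ : 0 ≤ β) :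
    IntegrableOn (fun v : ℝ => (α + β * v) ^ k * Real.exp (-v)) (Ioi 0) := by
  have h1 := (integrableOn_rpow_mul_exp_neg hk).const_mul (2 ^ k * β ^ k)
  have h2 := (integrableOn_rpow_mul_exp_neg le_rfl).const_mul (2 ^ k * α ^ k)
  refine Integrable.mono' (h1.add h2) (by fun_prop) ?_
  refine (ae_restrict_iff' measurableSet_Ioi).2 (Filter.Eventually.of_forall fun v hv => ?_)
  have hv' : 0 ≤ v := le_of_lt hv
  have h := abs_add_rpow_le hk (β * v) α
  have hβv : 0 ≤ β * v := by positivity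
  rw [abs_of_nonneg hβv, abs_of_nonneg hα, abs_of_nonneg (by positivity),
    Real.mul_rpow hβ hv', add_comm (β * v)] at h
  rw [Real.norm_of_nonneg (by positivity)]
  simp only [Pi.add_apply, Real.rpow_zero, one_mul]
  have := mul_le_mul_of_nonneg_right h (Real.exp_pos (-v)).le
  linarith

/-- The absolute moment of order `k` of `f_{α,γ}`, in terms of `α` and `β = 1 / γ`. -/
def flatMoment (k α β : ℝ) : ℝ :=
  (α ^ (k + 1) / (k + 1) + β * ∫ v in Ioi (0 : ℝ), (α + β * v) ^ k * Real.exp (-v)) / (α + β)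

lemma setIntegral_rpow_Ioc {k α : ℝ} (hk : 0 ≤ k) (hα : 0 ≤ α) :
    ∫ x in Ioc 0 α, x ^ k = α ^ (k + 1) / (k + 1) := by
  rw [← intervalIntegral.integral_of_le hα, integral_rpow (Or.inl (by linarith)),
    Real.zero_rpow (by linarith), sub_zero]

lemma integral_rpow_mul_uniformDensity {k α : ℝ} (hk : 0 ≤ k) (hα : 0 < α) :
    ∫ x, |x| ^ k * uniformDensity α x = flatMoment k α 0 := by
  have h1 : ∀ x, |x| ^ k * uniformDensity α x
      = (fun y => (Iic α).indicator (fun y => 1 / (2 * α) * y ^ k) y) |x| := fun x => by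
    simp only [uniformDensity, indicator, mem_Iic]
    split_ifs <;> ring
  simp only [h1]
  rw [integral_comp_abs (f := fun y => (Iic α).indicator (fun y => 1 / (2 * α) * y ^ k) y),
    setIntegral_indicator measurableSet_Iic, Ioi_inter_Iic, integral_const_mul,
    setIntegral_rpow_Ioc hk hα.le, flatMoment]
  field_simp
  ring

/-- Substitution x = α + βv, done on the whole line with indicators so that translation and scaling
of Lebesgue measure apply. -/
lemma integral_rpow_mul_exp_tail {k α β : ℝ} (hk : 0 ≤ k) (hα : 0 ≤ α) (hβ : 0 < β) :
    IntegrableOn (fun x : ℝ => x ^ k * Real.exp (-(β⁻¹ * (x - α)))) (Ioi α) ∧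
    ∫ x in Ioi α, x ^ k * Real.exp (-(β⁻¹ * (x - α)))
      = β * ∫ v in Ioi (0 : ℝ), (α + β * v) ^ k * Real.exp (-v) := by
  set J : ℝ → ℝ := (Ioi α).indicator fun x => x ^ k * Real.exp (-(β⁻¹ * (x - α))) with hJ
  have e : ∀ v, J (α + β * v)
      = (Ioi 0).indicator (fun v => (α + β * v) ^ k * Real.exp (-v)) v := by
    intro v
    have : α + β * v ∈ Ioi α ↔ v ∈ Ioi 0 := by simp [hβ]
    by_cases hv : v ∈ Ioi (0 : ℝ)
    · rw [hJ, indicator_of_mem (this.2 hv), indicator_of_mem hv, add_sub_cancel_left,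
        inv_mul_cancel_left₀ hβ.ne']
    · rw [hJ, indicator_of_notMem (fun h => hv (this.1 h)), indicator_of_notMem hv]
  constructor
  · rw [← integrable_indicator_iff measurableSet_Ioi]
    have h1 : Integrable fun v => J (α + β * v) := by
      simp only [e]
      exact (integrable_indicator_iff measurableSet_Ioi).2
        (integrableOn_affine_rpow_mul_exp hk hα hβ.le)
    have h2 := (integrable_comp_mul_left_iff (fun y => J (α + y)) hβ.ne').1 h1
    simpa using h2.comp_add_left (-α)
  · rw [← integral_indicator measurableSet_Ioi, ← integral_indicator measurableSet_Ioi, ← hJ]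
    simp only [← e]
    rw [Measure.integral_comp_mul_left (fun y => J (α + y)), integral_add_left_eq_self J,
      abs_of_pos (inv_pos.2 hβ), smul_eq_mul, mul_inv_cancel_left₀ hβ.ne']

/-- The absolute moments of `f_{α,γ}` with `γ = 1 / β`. -/
lemma integral_rpow_mul_flatExpDensity {k α β : ℝ} (hk : 0 ≤ k) (hα : 0 ≤ α) (hβ : 0 ≤ β)
    (hαβ : 0 < α + β) :
    ∫ x, |x| ^ k * flatExpDensity α (ENNReal.ofReal β)⁻¹ x = flatMoment k α β := by
  -- At β = 0 the inverse in `ℝ≥0∞` is `⊤`, which selects the uniform density.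
  rcases hβ.eq_or_lt with rfl | hβ
  · rw [← integral_rpow_mul_uniformDensity hk (by simpa using hαβ)]
    simp [flatExpDensity]
  have hne : (ENNReal.ofReal β)⁻¹ ≠ ⊤ := by simpa using hβ
  have hre : ((ENNReal.ofReal β)⁻¹).toReal = β⁻¹ := by
    rw [ENNReal.toReal_inv, ENNReal.toReal_ofReal hβ.le]
  set F : ℝ → ℝ := fun x => x ^ k * Real.exp (-(β⁻¹ * max (x - α) 0)) with hF
  have h1 : ∀ x, |x| ^ k * flatExpDensity α (ENNReal.ofReal β)⁻¹ x
      = 1 / (2 * (α + β)) * F |x| := fun x => by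
    simp only [flatExpDensity, hne, if_false, hre, hF, one_div, inv_inv]
    ring
  simp only [h1]
  rw [integral_const_mul, integral_comp_abs, ← Ioc_union_Ioi_eq_Ioi hα]
  obtain ⟨hi, ht⟩ := integral_rpow_mul_exp_tail hk hα hβ
  have e1 : EqOn F (fun x => x ^ k) (Ioc 0 α) := fun x hx => by
    simp [hF, max_eq_right (sub_nonpos.2 hx.2)]
  have e2 : EqOn F (fun x => x ^ k * Real.exp (-(β⁻¹ * (x - α)))) (Ioi α) := fun x hx => by
    simp only [hF]
    rw [max_eq_left (sub_nonneg.2 (le_of_lt hx))]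
  have hi1 : IntegrableOn F (Ioc 0 α) := by
    refine IntegrableOn.congr_fun ?_ e1.symm measurableSet_Ioc
    exact (intervalIntegral.intervalIntegrable_rpow' (by linarith)).1
  rw [setIntegral_union Ioc_disjoint_Ioi_same measurableSet_Ioi hi1
    (hi.congr_fun e2.symm measurableSet_Ioi), setIntegral_congr_fun measurableSet_Ioc e1,
    setIntegral_congr_fun measurableSet_Ioi e2, ht, setIntegral_rpow_Ioc hk hα, flatMoment]
  field_simp

/-- Dilation of the variable by l. It reduces the two parameters to the segment α + β = 1 together
with a scale. -/
lemma flatMoment_scale {k α β l : ℝ} (hα : 0 ≤ α) (hβ : 0 ≤ β) (hl : 0 < l)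
    (hαβ : 0 < α + β) : flatMoment k (l * α) (l * β) = l ^ k * flatMoment k α β := by
  have h : ∫ v in Ioi (0 : ℝ), (l * α + l * β * v) ^ k * Real.exp (-v)
      = l ^ k * ∫ v in Ioi (0 : ℝ), (α + β * v) ^ k * Real.exp (-v) := by
    rw [← integral_const_mul]
    refine setIntegral_congr_fun measurableSet_Ioi fun v hv => ?_
    have hv' : 0 ≤ v := le_of_lt hv
    have : l * α + l * β * v = l * (α + β * v) := by ring
    rw [this, Real.mul_rpow hl.le (by positivity), mul_assoc]
  rw [flatMoment, flatMoment, h, Real.mul_rpow hl.le hα, Real.rpow_add_one hl.ne']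
  field_simp

lemma flatMoment_zero {α β : ℝ} (hαβ : 0 < α + β) : flatMoment 0 α β = 1 := by
  simp only [flatMoment, Real.rpow_zero, one_mul, zero_add, Real.rpow_one,
    integral_exp_neg_Ioi_zero]
  field_simp

lemma flatMoment_exponential {k : ℝ} (hk : 0 ≤ k) : flatMoment k 0 1 = Real.Gamma (k + 1) := by
  simp [flatMoment, Real.zero_rpow (show k + 1 ≠ 0 by linarith), integral_rpow_mul_exp_neg hk]

lemma flatMoment_uniform (k : ℝ) : flatMoment k 1 0 = 1 / (k + 1) := by
  simp [flatMoment]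

lemma continuousOn_flatMoment {k : ℝ} (hk : 0 ≤ k) :
    ContinuousOn (fun θ => flatMoment k θ (1 - θ)) (Icc 0 1) := by
  have hI : ContinuousOn (fun θ : ℝ => ∫ v in Ioi (0 : ℝ), (θ + (1 - θ) * v) ^ k * Real.exp (-v))
      (Icc 0 1) := by
    refine continuousOn_of_dominated (fun θ _ => by fun_prop) (fun θ hθ => ?_)
      (integrableOn_affineBound hk) (Filter.Eventually.of_forall fun v => ?_)
    · refine (ae_restrict_iff' measurableSet_Ioi).2 (Filter.Eventually.of_forall fun v hv => ?_)
      have hv' : 0 ≤ v := le_of_lt hv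
      have h1 : 0 ≤ 1 - θ := by linarith [hθ.2]
      have h0 := hθ.1
      rw [Real.norm_of_nonneg (by positivity)]
      exact mul_le_mul_of_nonneg_right (affine_rpow_le hk h0 h1 hv' hθ.2 (by linarith))
        (Real.exp_pos _).le
    · refine Continuous.continuousOn ?_
      exact (Continuous.rpow_const (by fun_prop) fun _ => Or.inr hk).mul continuous_const
  have h1 : Continuous fun θ : ℝ => θ ^ (k + 1) / (k + 1) :=
    (Continuous.rpow_const continuous_id fun _ => Or.inr (by linarith)).div_const _
  have h2 : Continuous fun θ : ℝ => 1 - θ := by fun_prop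
  refine ((h1.continuousOn.add (h2.continuousOn.mul hI)).div_const 1).congr fun θ _ => ?_
  simp [flatMoment]

lemma flatMoment_pos {k θ : ℝ} (hk : 0 ≤ k) (hθ : θ ∈ Icc (0 : ℝ) 1) :
    0 < flatMoment k θ (1 - θ) := by
  rcases hθ.1.eq_or_lt with rfl | h0
  · rw [sub_zero, flatMoment_exponential hk]
    exact Real.Gamma_pos_of_pos (by linarith)
  · have h1 : 0 ≤ 1 - θ := by linarith [hθ.2]
    have h2 : 0 ≤ ∫ v in Ioi (0 : ℝ), (θ + (1 - θ) * v) ^ k * Real.exp (-v) :=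
      setIntegral_nonneg measurableSet_Ioi fun v hv => by
        have hv' : 0 ≤ v := le_of_lt hv
        positivity
    have : 0 < θ ^ (k + 1) / (k + 1) := by positivity
    rw [flatMoment]
    refine div_pos ?_ (by linarith)
    have := mul_nonneg h1 h2
    linarith

lemma mem_familyMinus_of_params {α β : ℝ} (hα : 0 ≤ α) (hαβ : 0 < α + β) :
    flatExpDensity α (ENNReal.ofReal β)⁻¹ ∈ familyMinus := by
  refine ⟨α, _, hα, by simp, fun h => ?_, rfl⟩
  have : β ≤ 0 := by simpa using h
  linarith

lemma integral_eq_one_of_mem_familyMinus {f : ℝ → ℝ} (hf : f ∈ familyMinus) : ∫ x, f x = 1 := by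
  obtain ⟨α, γ, hα, hγ, hαγ, rfl⟩ := hf
  have hne : γ⁻¹ ≠ ⊤ := by simpa using hγ.ne'
  have e : γ = (ENNReal.ofReal (γ⁻¹).toReal)⁻¹ := by
    rw [ENNReal.ofReal_toReal hne, inv_inv]
  have hpos : 0 < α + (γ⁻¹).toReal := by
    by_cases h : γ = ⊤
    · have := hαγ h
      positivity
    · have : 0 < (γ⁻¹).toReal := ENNReal.toReal_pos (by simpa using h) hne
      linarith
  have h := integral_rpow_mul_flatExpDensity le_rfl hα (ENNReal.toReal_nonneg (a := γ⁻¹)) hpos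
  rw [← e, flatMoment_zero hpos] at h
  simpa using h

/-! ### Moments of the densities `g_{α,γ}` -/

/-- The integrand of `truncMoment`. -/
def truncIntegrand (k δ γ x : ℝ) : ℝ := if δ * x ≤ 1 then x ^ k * Real.exp (-(γ * x)) else 0

/-- The unnormalised moment of order `k` of `g_{α,γ}` on the half-line, in terms of `δ = 1 / α` and
`γ`. -/
def truncMoment (k δ γ : ℝ) : ℝ := ∫ x in Ioi (0 : ℝ), truncIntegrand k δ γ x

lemma truncMoment_of_pos (k γ : ℝ) {δ : ℝ} (hδ : 0 < δ) :
    truncMoment k δ γ = ∫ x in Ioc 0 δ⁻¹, x ^ k * Real.exp (-(γ * x)) := by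
  have : truncIntegrand k δ γ = (Iic δ⁻¹).indicator fun x => x ^ k * Real.exp (-(γ * x)) := by
    ext x
    simp only [truncIntegrand, indicator, mem_Iic]
    congr 1
    rw [eq_iff_iff, ← one_div, le_div_iff₀ hδ, mul_comm]
  rw [truncMoment, this, setIntegral_indicator measurableSet_Iic, Ioi_inter_Iic]

lemma truncMoment_zero_of_pos {δ γ : ℝ} (hδ : 0 < δ) (hγ : 0 < γ) :
    truncMoment 0 δ γ = (1 - Real.exp (-(δ⁻¹ * γ))) / γ := by
  rw [truncMoment_of_pos _ _ hδ, ← intervalIntegral.integral_of_le (by positivity)]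
  have : ∀ x : ℝ, x ^ (0 : ℝ) * Real.exp (-(γ * x)) = Real.exp (-γ * x) := fun x => by simp
  simp only [this]
  rw [intervalIntegral.integral_comp_mul_left (fun x => Real.exp x) (by linarith), integral_exp,
    smul_eq_mul, mul_zero, Real.exp_zero, mul_comm (-γ), mul_neg]
  field_simp
  ring

lemma truncMoment_uniform {k δ : ℝ} (hk : 0 ≤ k) (hδ : 0 < δ) :
    truncMoment k δ 0 = δ⁻¹ ^ (k + 1) / (k + 1) := by
  rw [truncMoment_of_pos _ _ hδ, ← setIntegral_rpow_Ioc hk (inv_nonneg.2 hδ.le)]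
  simp

/-- Dilation by l; the extra power of l is the Jacobian, which cancels on dividing by the moment of
order 0. With δ = 1 / α the value δ = 0 means no truncation. -/
lemma truncMoment_scale {k δ γ l : ℝ} (hl : 0 < l) :
    truncMoment k (δ / l) (γ / l) = l ^ (k + 1) * truncMoment k δ γ := by
  have h := integral_comp_mul_left_Ioi (truncIntegrand k (δ / l) (γ / l)) 0 hl
  have e : ∫ x in Ioi (0 : ℝ), truncIntegrand k (δ / l) (γ / l) (l * x)
      = l ^ k * truncMoment k δ γ := by
    rw [truncMoment, ← integral_const_mul]
    refine setIntegral_congr_fun measurableSet_Ioi fun x hx => ?_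
    have h1 : δ / l * (l * x) = δ * x := by field_simp
    have h2 : γ / l * (l * x) = γ * x := by field_simp
    simp only [truncIntegrand, h1, h2]
    rw [Real.mul_rpow hl.le (le_of_lt hx)]
    split_ifs <;> ring
  rw [e, mul_zero, smul_eq_mul, ← truncMoment] at h
  rw [Real.rpow_add_one hl.ne']
  field_simp at h
  linarith

lemma truncMoment_exponential {k : ℝ} (hk : 0 ≤ k) : truncMoment k 0 1 = Real.Gamma (k + 1) := by
  simp [truncMoment, truncIntegrand, integral_rpow_mul_exp_neg hk]

lemma truncIntegrand_nonneg (k δ γ : ℝ) {x : ℝ} (hx : 0 < x) : 0 ≤ truncIntegrand k δ γ x := by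
  unfold truncIntegrand
  split_ifs <;> positivity

lemma measurable_truncIntegrand (k δ γ : ℝ) : Measurable (truncIntegrand k δ γ) :=
  Measurable.ite (measurableSet_le (by fun_prop) measurable_const) (by fun_prop) measurable_const

/-- On the support (1 - θ) x ≤ 1, that is, -θx ≤ 1 - x. This gives a dominating function independent
of θ. -/
lemma truncIntegrand_le {k θ x : ℝ} (hx : 0 < x) :
    ‖truncIntegrand k (1 - θ) θ x‖ ≤ Real.exp 1 * (x ^ k * Real.exp (-x)) := by
  rw [Real.norm_of_nonneg (truncIntegrand_nonneg _ _ _ hx), truncIntegrand]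
  split_ifs with h
  · have h1 : Real.exp (-(θ * x)) ≤ Real.exp 1 * Real.exp (-x) := by
      rw [← Real.exp_add, Real.exp_le_exp]; linarith
    have h2 : 0 ≤ x ^ k := by positivity
    nlinarith
  · positivity

lemma integrableOn_truncIntegrand {k : ℝ} (hk : 0 ≤ k) (θ : ℝ) :
    IntegrableOn (truncIntegrand k (1 - θ) θ) (Ioi 0) := by
  refine Integrable.mono' ((integrableOn_rpow_mul_exp_neg hk).const_mul (Real.exp 1))
    (measurable_truncIntegrand _ _ _).aestronglyMeasurable ?_
  exact (ae_restrict_iff' measurableSet_Ioi).2 (Filter.Eventually.of_forall fun v hv =>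
    truncIntegrand_le hv)

lemma continuousOn_truncMoment {k : ℝ} (hk : 0 ≤ k) :
    ContinuousOn (fun θ => truncMoment k (1 - θ) θ) (Icc 0 1) := by
  intro θ _
  refine continuousWithinAt_of_dominated (bound := fun x => Real.exp 1 * (x ^ k * Real.exp (-x)))
    (Filter.Eventually.of_forall fun θ => (measurable_truncIntegrand _ _ _).aestronglyMeasurable)
    (Filter.Eventually.of_forall fun θ => (ae_restrict_iff' measurableSet_Ioi).2
      (Filter.Eventually.of_forall fun v hv => truncIntegrand_le hv))
    ((integrableOn_rpow_mul_exp_neg hk).const_mul (Real.exp 1)) ?_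
  refine ae_restrict_of_ae ?_
  -- For fixed x the integrand jumps in θ only where (1 - θ) x = 1, which excludes a single x for
  -- each θ.
  filter_upwards [Measure.ae_ne volume ((1 - θ)⁻¹)] with x hx
  apply ContinuousAt.continuousWithinAt
  have hne : (1 - θ) * x ≠ 1 := fun h => hx (eq_inv_of_mul_eq_one_right h)
  have hc : Continuous fun θ : ℝ => (1 - θ) * x := by fun_prop
  rcases lt_or_gt_of_ne hne with h | h
  · have : (fun θ : ℝ => x ^ k * Real.exp (-(θ * x))) =ᶠ[nhds θ]
        fun θ => truncIntegrand k (1 - θ) θ x := by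
      filter_upwards [hc.continuousAt.eventually_lt continuousAt_const h] with η hη
      simp [truncIntegrand, hη.le]
    exact ContinuousAt.congr (by fun_prop) this
  · have : (fun _ : ℝ => (0 : ℝ)) =ᶠ[nhds θ] fun θ => truncIntegrand k (1 - θ) θ x := by
      filter_upwards [continuousAt_const.eventually_lt hc.continuousAt h] with η hη
      simp [truncIntegrand, not_le.2 hη]
    exact continuousAt_const.congr this

lemma truncMoment_pos {k θ : ℝ} (hk : 0 ≤ k) (hθ : θ ∈ Icc (0 : ℝ) 1) :
    0 < truncMoment k (1 - θ) θ := by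
  rw [truncMoment, setIntegral_pos_iff_support_of_nonneg_ae
    ((ae_restrict_iff' measurableSet_Ioi).2 (Filter.Eventually.of_forall fun v hv =>
      truncIntegrand_nonneg _ _ _ hv)) (integrableOn_truncIntegrand hk θ)]
  refine lt_of_lt_of_le ?_ (measure_mono (s := Ioo (0 : ℝ) 1) fun x hx => ⟨?_, hx.1⟩)
  · simp
  · have h : (1 - θ) * x ≤ 1 := by nlinarith [hx.1, hx.2, hθ.1, hθ.2]
    have := hx.1
    simp only [Function.mem_support, truncIntegrand, h, if_true]
    positivity

/-- The density `g_{α,γ}` with `α = 1 / δ`. -/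
lemma truncExpDensity_eq {δ γ : ℝ} (hδ : 0 ≤ δ) (hγ : 0 ≤ γ) (h : 0 < δ + γ) (x : ℝ) :
    truncExpDensity (ENNReal.ofReal δ)⁻¹ γ x
      = (2 * truncMoment 0 δ γ)⁻¹ * truncIntegrand 0 δ γ |x| := by
  have hre : ((ENNReal.ofReal δ)⁻¹).toReal = δ⁻¹ := by
    rw [ENNReal.toReal_inv, ENNReal.toReal_ofReal hδ]
  have hle : 0 < δ → (|x| ≤ δ⁻¹ ↔ δ * |x| ≤ 1) := fun hδ => by
    rw [← one_div, le_div_iff₀ hδ, mul_comm]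
  rcases hγ.eq_or_lt with rfl | hγ
  · have hδ : 0 < δ := by simpa using h
    rw [truncMoment_uniform le_rfl hδ]
    simp only [truncExpDensity, if_true, uniformDensity, truncIntegrand, hre, hle hδ]
    split_ifs <;> simp
  rcases hδ.eq_or_lt with rfl | hδ
  · have h1 : truncMoment 0 0 γ = γ⁻¹ := by
      have := truncMoment_scale (k := 0) (δ := 0) (γ := 1) (inv_pos.2 hγ)
      rw [truncMoment_exponential le_rfl] at this
      simpa using this
    rw [h1]
    simp only [truncExpDensity, hγ.ne', if_false, truncIntegrand]
    simp
    ring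
  · have h1 : (ENNReal.ofReal δ)⁻¹ ≠ ⊤ := by simpa using hδ
    rw [truncMoment_zero_of_pos hδ hγ]
    simp only [truncExpDensity, hγ.ne', h1, if_false, truncIntegrand, hre, hle hδ]
    split_ifs
    · rw [← mul_div_assoc, inv_div, Real.rpow_zero, one_mul]
    · simp

lemma integral_rpow_mul_truncExpDensity (k : ℝ) {δ γ : ℝ} (hδ : 0 ≤ δ) (hγ : 0 ≤ γ)
    (h : 0 < δ + γ) :
    ∫ x, |x| ^ k * truncExpDensity (ENNReal.ofReal δ)⁻¹ γ x
      = truncMoment k δ γ / truncMoment 0 δ γ := by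
  have e : ∀ x, |x| ^ k * truncExpDensity (ENNReal.ofReal δ)⁻¹ γ x
      = (2 * truncMoment 0 δ γ)⁻¹ * truncIntegrand k δ γ |x| := fun x => by
    rw [truncExpDensity_eq hδ hγ h]
    simp only [truncIntegrand, Real.rpow_zero]
    split_ifs <;> ring
  simp only [e]
  rw [integral_const_mul, integral_comp_abs, ← truncMoment, mul_inv]
  ring

lemma mem_familyPlus_of_params {δ γ : ℝ} (hγ : 0 ≤ γ) (h : 0 < δ + γ) :
    truncExpDensity (ENNReal.ofReal δ)⁻¹ γ ∈ familyPlus := by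
  refine ⟨_, γ, by simp, hγ, fun h' => ?_, rfl⟩
  have : δ ≤ 0 := by simpa using h'
  linarith

lemma integral_eq_one_of_mem_familyPlus {f : ℝ → ℝ} (hf : f ∈ familyPlus) : ∫ x, f x = 1 := by
  obtain ⟨α, γ, hα, hγ, hαγ, rfl⟩ := hf
  have hne : α⁻¹ ≠ ⊤ := by simpa using hα.ne'
  have e : α = (ENNReal.ofReal (α⁻¹).toReal)⁻¹ := by
    rw [ENNReal.ofReal_toReal hne, inv_inv]
  set δ := (α⁻¹).toReal with hδdef
  have hδ : 0 ≤ δ := ENNReal.toReal_nonneg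
  have hpos : 0 < δ + γ := by
    by_cases h : α = ⊤
    · have := hαγ h
      positivity
    · have : 0 < δ := ENNReal.toReal_pos (by simpa using h) hne
      linarith
  have h := integral_rpow_mul_truncExpDensity 0 hδ hγ hpos
  -- Rescaling to the segment δ + γ = 1 shows that the normalising constant is nonzero, so its
  -- quotient by itself is 1.
  have hs := truncMoment_scale (k := 0) (δ := 1 - γ / (δ + γ)) (γ := γ / (δ + γ))
    (inv_pos.2 hpos)
  have e1 : (1 - γ / (δ + γ)) / (δ + γ)⁻¹ = δ := by field_simp; ring
  have e2 : γ / (δ + γ) / (δ + γ)⁻¹ = γ := by field_simp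
  rw [e1, e2] at hs
  have hp := truncMoment_pos (k := 0) (θ := γ / (δ + γ)) le_rfl
    ⟨by positivity, by rw [div_le_one hpos]; linarith⟩
  have : truncMoment 0 δ γ ≠ 0 := by rw [hs]; positivity
  rw [← e, div_self this] at h
  simpa using h

/-! ### Existence of members with prescribed moments -/

/-- Intermediate values of the scale-invariant moment ratio. -/
lemma exists_scale {p a b : ℝ} (hp : 4 < p) (ha : 0 < a) (hb : 0 < b)
    (hlow : (3 : ℝ) ^ (1 / 2 : ℝ) * (p + 1) ^ (-(1 / p)) ≤ b / a)
    (hupp : b / a ≤ (2 : ℝ) ^ (-(1 / 2) : ℝ) * Real.Gamma (p + 1) ^ (1 / p))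
    {M N : ℝ → ℝ} (hM : ContinuousOn M (Icc 0 1)) (hN : ContinuousOn N (Icc 0 1))
    (hMpos : ∀ θ ∈ Icc (0 : ℝ) 1, 0 < M θ) {u v : ℝ} (hu : u ∈ Icc (0 : ℝ) 1)
    (hv : v ∈ Icc (0 : ℝ) 1) (Mu : M u = 1 / 3) (Nu : N u = 1 / (p + 1)) (Mv : M v = 2)
    (Nv : N v = Real.Gamma (p + 1)) :
    ∃ θ ∈ Icc (0 : ℝ) 1, ∃ l : ℝ, 0 < l ∧ l ^ 2 * M θ = a ^ 2 ∧ l ^ p * N θ = b ^ p := by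
  have hp0 : 0 < p := by linarith
  have hG : 0 < Real.Gamma (p + 1) := Real.Gamma_pos_of_pos (by linarith)
  -- This ratio does not change under dilation. The two bounds on b / a place (b / a)^p between its
  -- values for the uniform density (at u) and the exponential density (at v).
  have hR : ContinuousOn (fun θ => N θ / M θ ^ (p / 2)) (Icc 0 1) :=
    hN.div (hM.rpow_const fun θ hθ => Or.inl (hMpos θ hθ).ne')
      fun θ hθ => (Real.rpow_pos_of_pos (hMpos θ hθ) _).ne'
  have h1 : N u / M u ^ (p / 2) ≤ (b / a) ^ p := by
    have := Real.rpow_le_rpow (by positivity) hlow hp0.le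
    rw [Real.mul_rpow (by positivity) (by positivity), ← Real.rpow_mul (by norm_num),
      ← Real.rpow_mul (by positivity)] at this
    convert this using 1
    rw [Mu, Nu, one_div 3, Real.inv_rpow (by norm_num), show -(1 / p) * p = -1 by field_simp,
      Real.rpow_neg_one, show 1 / 2 * p = p / 2 by ring]
    field_simp
  have h2 : (b / a) ^ p ≤ N v / M v ^ (p / 2) := by
    have := Real.rpow_le_rpow (by positivity) hupp hp0.le
    rw [Real.mul_rpow (by positivity) (by positivity), ← Real.rpow_mul (by norm_num),
      ← Real.rpow_mul hG.le] at this
    convert this using 1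
    rw [Mv, Nv, show -(1 / 2) * p = -(p / 2) by ring, Real.rpow_neg (by norm_num),
      show 1 / p * p = 1 by field_simp, Real.rpow_one]
    field_simp
  obtain ⟨θ, hθ, hval⟩ := isPreconnected_Icc.intermediate_value hu hv hR ⟨h1, h2⟩
  have hm := hMpos θ hθ
  -- The second moment dictates the scale; the ratio then makes the p-th moment right.
  refine ⟨θ, hθ, a / √(M θ), by positivity, ?_, ?_⟩
  · rw [div_pow, Real.sq_sqrt hm.le]; field_simp
  · simp only at hval
    rw [Real.div_rpow ha.le (by positivity), Real.sqrt_eq_rpow, ← Real.rpow_mul hm.le,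
      show 1 / 2 * p = p / 2 by ring]
    rw [Real.div_rpow hb.le ha.le] at hval
    have : 0 < M θ ^ (p / 2) := by positivity
    have : 0 < a ^ p := by positivity
    field_simp at hval ⊢
    exact hval

lemma hasDensityMoments_iff_abs {p a b : ℝ} {f : ℝ → ℝ} :
    HasDensityMoments p a b f ↔
      ∫ x, |x| ^ (2 : ℝ) * f x = a ^ 2 ∧ ∫ x, |x| ^ p * f x = b ^ p := by
  simp [HasDensityMoments, sq_abs]

lemma exists_mem_familyMinus {p a b : ℝ} (hp : 4 < p) (ha : 0 < a) (hb : 0 < b)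
    (hlow : (3 : ℝ) ^ (1 / 2 : ℝ) * (p + 1) ^ (-(1 / p)) ≤ b / a)
    (hupp : b / a ≤ (2 : ℝ) ^ (-(1 / 2) : ℝ) * Real.Gamma (p + 1) ^ (1 / p)) :
    ∃ f ∈ familyMinus, HasDensityMoments p a b f := by
  have hp0 : 0 ≤ p := by linarith
  -- Here θ is α and 1 - θ is 1 / γ, so θ = 1 is uniform and θ = 0 exponential. In
  -- `exists_mem_familyPlus` θ is γ and the ends are exchanged.
  obtain ⟨θ, hθ, l, hl, h1, h2⟩ := exists_scale hp ha hb hlow hupp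
    (continuousOn_flatMoment zero_le_two) (continuousOn_flatMoment hp0)
    (fun θ hθ => flatMoment_pos zero_le_two hθ) (u := 1) (v := 0) (by simp) (by simp)
    (by rw [sub_self, flatMoment_uniform]; norm_num) (by rw [sub_self, flatMoment_uniform])
    (by rw [sub_zero, flatMoment_exponential zero_le_two, Real.Gamma_add_one two_ne_zero,
      Real.Gamma_two]; norm_num)
    (by rw [sub_zero, flatMoment_exponential hp0])
  have h0 := hθ.1
  have h0' : 0 ≤ 1 - θ := by linarith [hθ.2]
  have hA : 0 ≤ l * θ := by positivity
  have hB : 0 ≤ l * (1 - θ) := by positivity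
  have hAB : 0 < l * θ + l * (1 - θ) := by linarith
  refine ⟨_, mem_familyMinus_of_params hA hAB, hasDensityMoments_iff_abs.2 ⟨?_, ?_⟩⟩
  · rw [integral_rpow_mul_flatExpDensity zero_le_two hA hB hAB,
      flatMoment_scale h0 h0' hl (by linarith), Real.rpow_two, h1]
  · rw [integral_rpow_mul_flatExpDensity hp0 hA hB hAB,
      flatMoment_scale h0 h0' hl (by linarith), h2]

lemma exists_mem_familyPlus {p a b : ℝ} (hp : 4 < p) (ha : 0 < a) (hb : 0 < b)
    (hlow : (3 : ℝ) ^ (1 / 2 : ℝ) * (p + 1) ^ (-(1 / p)) ≤ b / a)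
    (hupp : b / a ≤ (2 : ℝ) ^ (-(1 / 2) : ℝ) * Real.Gamma (p + 1) ^ (1 / p)) :
    ∃ f ∈ familyPlus, HasDensityMoments p a b f := by
  have hp0 : 0 ≤ p := by linarith
  have hc := continuousOn_truncMoment (k := 0) le_rfl
  have hpos : ∀ θ ∈ Icc (0 : ℝ) 1, 0 < truncMoment 0 (1 - θ) θ :=
    fun θ hθ => truncMoment_pos le_rfl hθ
  have hq : ∀ k : ℝ, 0 ≤ k → ContinuousOn
      (fun θ => truncMoment k (1 - θ) θ / truncMoment 0 (1 - θ) θ) (Icc 0 1) := fun k hk =>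
    (continuousOn_truncMoment hk).div hc fun θ hθ => (hpos θ hθ).ne'
  have hunif : ∀ k : ℝ, 0 ≤ k → truncMoment k (1 - 0) 0 / truncMoment 0 (1 - 0) 0 = 1 / (k + 1) :=
    fun k hk => by
      rw [sub_zero, truncMoment_uniform hk one_pos, truncMoment_uniform le_rfl one_pos]; simp
  have hexp : ∀ k : ℝ, 0 ≤ k →
      truncMoment k (1 - 1) 1 / truncMoment 0 (1 - 1) 1 = Real.Gamma (k + 1) := fun k hk => by
    rw [sub_self, truncMoment_exponential hk, truncMoment_exponential le_rfl]; simp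
  obtain ⟨θ, hθ, l, hl, h1, h2⟩ := exists_scale hp ha hb hlow hupp
    (hq 2 zero_le_two) (hq p hp0)
    (fun θ hθ => div_pos (truncMoment_pos zero_le_two hθ) (hpos θ hθ)) (u := 0) (v := 1)
    (by simp) (by simp)
    (by rw [hunif 2 zero_le_two]; norm_num) (hunif p hp0)
    (by rw [hexp 2 zero_le_two, Real.Gamma_add_one two_ne_zero, Real.Gamma_two]; norm_num)
    (hexp p hp0)
  have h0' : 0 ≤ 1 - θ := by linarith [hθ.2]
  have hA : 0 ≤ (1 - θ) / l := by positivity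
  have hB : 0 ≤ θ / l := div_nonneg hθ.1 hl.le
  have hAB : 0 < (1 - θ) / l + θ / l := by rw [← add_div]; simpa using hl
  have hscale : ∀ k : ℝ, truncMoment k ((1 - θ) / l) (θ / l) / truncMoment 0 ((1 - θ) / l) (θ / l)
      = l ^ k * (truncMoment k (1 - θ) θ / truncMoment 0 (1 - θ) θ) := fun k => by
    rw [truncMoment_scale hl, truncMoment_scale hl, Real.rpow_add_one hl.ne', zero_add,
      Real.rpow_one]
    have := (hpos θ hθ).ne'
    field_simp
  refine ⟨_, mem_familyPlus_of_params hB hAB, hasDensityMoments_iff_abs.2 ⟨?_, ?_⟩⟩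
  · rw [integral_rpow_mul_truncExpDensity _ hA hB hAB, hscale, Real.rpow_two, h1]
  · rw [integral_rpow_mul_truncExpDensity _ hA hB hAB, hscale, h2]

/-! ### Comparison of shifted moments -/

/-- `f` is an even log-concave probability density with second moment `a ^ 2` and `p`-th moment
`b ^ p`. -/
structure IsEvenDensityWithMoments (p a b : ℝ) (f : ℝ → ℝ) : Prop where
  logConcave : IsEvenLogConcave f
  integral_eq_one : ∫ x, f x = 1
  moments : HasDensityMoments p a b f

namespace IsEvenDensityWithMoments

variable {p a b : ℝ} {f g : ℝ → ℝ}

/-- The integral of a non-integrable function is 0 by convention, so a nonzero value forces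
integrability. The same device serves for the other moments. -/
lemma integrable (hf : IsEvenDensityWithMoments p a b f) : Integrable f :=
  not_imp_comm.1 integral_undef (by rw [hf.integral_eq_one]; exact one_ne_zero)

lemma integrable_rpow (hb : 0 < b) (hf : IsEvenDensityWithMoments p a b f) :
    Integrable fun x => |x| ^ p * f x :=
  not_imp_comm.1 integral_undef (by rw [hf.moments.2]; positivity)

lemma vanishingMoments_sub (ha : 0 < a) (hb : 0 < b) (hf : IsEvenDensityWithMoments p a b f)
    (hg : IsEvenDensityWithMoments p a b g) : VanishingMoments p (f - g) := by
  have i2 : ∀ {h : ℝ → ℝ}, IsEvenDensityWithMoments p a b h → Integrable fun x => x ^ 2 * h x :=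
    fun h => not_imp_comm.1 integral_undef (by rw [h.moments.1]; positivity)
  refine ⟨fun x => ?_, hf.integrable.sub hg.integrable, ?_, ?_, ?_, ?_, ?_⟩
  · simp [hf.logConcave.even, hg.logConcave.even]
  · simp only [Pi.sub_apply, mul_sub]
    exact (i2 hf).sub (i2 hg)
  · simp only [Pi.sub_apply, mul_sub]
    exact (hf.integrable_rpow hb).sub (hg.integrable_rpow hb)
  · simp only [Pi.sub_apply]
    rw [integral_sub hf.integrable hg.integrable, hf.integral_eq_one, hg.integral_eq_one, sub_self]
  · simp only [Pi.sub_apply, mul_sub]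
    rw [integral_sub (i2 hf) (i2 hg), hf.moments.1, hg.moments.1, sub_self]
  · simp only [Pi.sub_apply, mul_sub]
    rw [integral_sub (hf.integrable_rpow hb) (hg.integrable_rpow hb), hf.moments.2, hg.moments.2,
      sub_self]

lemma integral_shift_le (hp : 4 < p) (ha : 0 < a) (hb : 0 < b)
    (hf : IsEvenDensityWithMoments p a b f) (hg : IsEvenDensityWithMoments p a b g)
    (hN : NoAlternation 3 (f - g) 0) (s : ℝ) :
    ∫ x, |x + s| ^ p * g x ≤ ∫ x, |x + s| ^ p * f x := by
  have h := (hf.vanishingMoments_sub ha hb hg).integral_shift_nonneg hp hN s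
  simp only [Pi.sub_apply, mul_sub] at h
  rw [integral_sub (integrable_shift_rpow_mul (by linarith) hf.integrable (hf.integrable_rpow hb) s)
    (integrable_shift_rpow_mul (by linarith) hg.integrable (hg.integrable_rpow hb) s)] at h
  linarith

lemma ae_eq (hp : 4 < p) (ha : 0 < a) (hb : 0 < b)
    (hf : IsEvenDensityWithMoments p a b f) (hg : IsEvenDensityWithMoments p a b g)
    (hN : NoAlternation 3 (f - g) 0) (hN' : NoAlternation 3 (g - f) 0) : f =ᵐ[volume] g := by
  filter_upwards [(hf.vanishingMoments_sub ha hb hg).eq_zero hp hN (by rwa [neg_sub])] with x hx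
  simpa [sub_eq_zero] using hx

end IsEvenDensityWithMoments

lemma isEvenDensityWithMoments_of_mem_familyMinus {p a b : ℝ} {f : ℝ → ℝ} (hf : f ∈ familyMinus)
    (hm : HasDensityMoments p a b f) : IsEvenDensityWithMoments p a b f :=
  ⟨(isClosedLogConcave_of_mem_familyMinus hf).isEvenLogConcave,
    integral_eq_one_of_mem_familyMinus hf, hm⟩

lemma isEvenDensityWithMoments_of_mem_familyPlus {p a b : ℝ} {f : ℝ → ℝ} (hf : f ∈ familyPlus)
    (hm : HasDensityMoments p a b f) : IsEvenDensityWithMoments p a b f :=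
  ⟨(isClosedLogConcave_of_mem_familyPlus hf).isEvenLogConcave,
    integral_eq_one_of_mem_familyPlus hf, hm⟩

/-- Two members with the same moments are each log-concave and flat-then-log-convex, so neither
difference alternates and they agree almost everywhere. Closed supports and continuous potentials
upgrade this to equality. -/
lemma isUniqueDensity_familyMinus {p a b : ℝ} (hp : 4 < p) (ha : 0 < a) (hb : 0 < b) {f : ℝ → ℝ}
    (hf : f ∈ familyMinus) (hm : HasDensityMoments p a b f) :
    IsUniqueDensity familyMinus p a b f := by
  refine ⟨hf, hm, fun g hg hgm => ?_⟩
  have hf' := isEvenDensityWithMoments_of_mem_familyMinus hf hm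
  have hg' := isEvenDensityWithMoments_of_mem_familyMinus hg hgm
  obtain ⟨_, hfa⟩ := isFlatThenLogConvex_of_mem_familyMinus hf
  obtain ⟨_, hga⟩ := isFlatThenLogConvex_of_mem_familyMinus hg
  exact (isClosedLogConcave_of_mem_familyMinus hg).eq_of_ae_eq
    (isClosedLogConcave_of_mem_familyMinus hf)
    (hg'.ae_eq hp ha hb hf' (hg'.logConcave.noAlternation_sub_flat hfa)
      (hf'.logConcave.noAlternation_sub_flat hga))

lemma isUniqueDensity_familyPlus {p a b : ℝ} (hp : 4 < p) (ha : 0 < a) (hb : 0 < b) {f : ℝ → ℝ}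
    (hf : f ∈ familyPlus) (hm : HasDensityMoments p a b f) :
    IsUniqueDensity familyPlus p a b f := by
  refine ⟨hf, hm, fun g hg hgm => ?_⟩
  have hf' := isEvenDensityWithMoments_of_mem_familyPlus hf hm
  have hg' := isEvenDensityWithMoments_of_mem_familyPlus hg hgm
  exact (isClosedLogConcave_of_mem_familyPlus hg).eq_of_ae_eq
    (isClosedLogConcave_of_mem_familyPlus hf)
    (hg'.ae_eq hp ha hb hf'
      (hf'.logConcave.noAlternation_logConvex_sub (isLogConvexOnSupport_of_mem_familyPlus hg))
      (hg'.logConcave.noAlternation_logConvex_sub (isLogConvexOnSupport_of_mem_familyPlus hf)))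

/-! ### Laws with a density -/

lemma integral_lawOfDensity {f : ℝ → ℝ} (hm : AEMeasurable f) (h0 : ∀ x, 0 ≤ f x) (F : ℝ → ℝ) :
    ∫ x, F x ∂(lawOfDensity f) = ∫ x, F x * f x := by
  rw [lawOfDensity, integral_withDensity_eq_integral_toReal_smul₀ hm.ennreal_ofReal
    (Filter.Eventually.of_forall fun _ => ENNReal.ofReal_lt_top)]
  congr 1 with x
  rw [ENNReal.toReal_ofReal (h0 x), smul_eq_mul, mul_comm]

lemma lintegral_lawOfDensity {f F : ℝ → ℝ} (h0 : ∀ x, 0 ≤ f x) (hm : AEMeasurable f)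
    (hF : Measurable F) (hF0 : ∀ x, 0 ≤ F x) (hi : Integrable fun x => F x * f x) :
    ∫⁻ x, ENNReal.ofReal (F x) ∂(lawOfDensity f) = ENNReal.ofReal (∫ x, F x * f x) := by
  rw [lawOfDensity, lintegral_withDensity_eq_lintegral_mul₀ hm.ennreal_ofReal
    hF.ennreal_ofReal.aemeasurable, ofReal_integral_eq_lintegral_ofReal hi
    (Filter.Eventually.of_forall fun x => mul_nonneg (hF0 x) (h0 x))]
  congr 1 with x
  rw [Pi.mul_apply, ← ENNReal.ofReal_mul (h0 x), mul_comm]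

lemma isProbabilityMeasure_lawOfDensity {f : ℝ → ℝ} (h0 : ∀ x, 0 ≤ f x) (h1 : ∫ x, f x = 1) :
    IsProbabilityMeasure (lawOfDensity f) := by
  have hi : Integrable f := not_imp_comm.1 integral_undef (by rw [h1]; exact one_ne_zero)
  constructor
  rw [lawOfDensity, withDensity_apply _ MeasurableSet.univ, Measure.restrict_univ,
    ← ofReal_integral_eq_lintegral_ofReal hi (Filter.Eventually.of_forall h0), h1,
    ENNReal.ofReal_one]

lemma map_neg_lawOfDensity (f : ℝ → ℝ) :
    (lawOfDensity f).map (fun x => -x) = lawOfDensity fun x => f (-x) := by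
  ext s hs
  rw [Measure.map_apply measurable_neg hs, lawOfDensity, lawOfDensity, withDensity_apply _ hs,
    withDensity_apply _ (measurable_neg hs)]
  have := (Measure.measurePreserving_neg (volume : Measure ℝ)).setLIntegral_comp_preimage_emb
    (MeasurableEquiv.neg ℝ).measurableEmbedding (fun x => ENNReal.ofReal (f (-x))) s
  simpa using this

/-- A symmetric log-concave random variable has an even log-concave density. -/
lemma exists_even_density {Ω : Type u} [MeasurableSpace Ω] {μ : Measure Ω}
    [IsProbabilityMeasure μ] {p a b : ℝ} {X : Ω → ℝ} (hX : Measurable X)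
    (hs : IdentDistrib X (fun ω => -X ω) μ μ) (hlc : IsLogConcave X μ)
    (h2 : ∫ ω, X ω ^ 2 ∂μ = a ^ 2) (hp : ∫ ω, |X ω| ^ p ∂μ = b ^ p) :
    ∃ f, IsEvenDensityWithMoments p a b f ∧ μ.map X = lawOfDensity f := by
  obtain ⟨f, hf, hlaw⟩ := hlc
  have : IsProbabilityMeasure (μ.map X) := Measure.isProbabilityMeasure_map hX.aemeasurable
  have hmf := hf.aemeasurable
  -- Symmetry of the law makes f even almost everywhere, since a finite measure determines its
  -- density up to null sets.
  have hsym : lawOfDensity f = lawOfDensity fun x => f (-x) := by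
    rw [← map_neg_lawOfDensity, ← hlaw, Measure.map_map measurable_neg hX]
    exact hs.map_eq
  have htop : ∫⁻ x, ENNReal.ofReal (f x) = 1 := by
    have := measure_univ (μ := μ.map X)
    rwa [hlaw, lawOfDensity, withDensity_apply _ MeasurableSet.univ, Measure.restrict_univ] at this
  have hmn : AEMeasurable fun x => f (-x) := hmf.comp_quasiMeasurePreserving
    (Measure.measurePreserving_neg (volume : Measure ℝ)).quasiMeasurePreserving
  have hae := (withDensity_eq_iff hmf.ennreal_ofReal hmn.ennreal_ofReal
    (by rw [htop]; exact ENNReal.one_ne_top)).1 hsym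
  obtain ⟨g, hg, hgf⟩ := hf.exists_even (by
    filter_upwards [hae] with x hx
    exact ((ENNReal.ofReal_eq_ofReal_iff (hf.nonneg _) (hf.nonneg _)).1 hx).symm)
  have hlaw' : μ.map X = lawOfDensity g := by
    rw [hlaw]
    refine withDensity_congr_ae ?_
    filter_upwards [hgf] with x hx
    rw [hx]
  have hmg : AEMeasurable g := hmf.congr hgf.symm
  refine ⟨g, ⟨hg, ?_, ?_, ?_⟩, hlaw'⟩
  · rw [integral_congr_ae hgf, integral_eq_lintegral_of_nonneg_ae
      (Filter.Eventually.of_forall hf.nonneg) hmf.aestronglyMeasurable, htop, ENNReal.toReal_one]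
  · rw [← integral_lawOfDensity hmg hg.nonneg, ← hlaw', ← h2,
      integral_map hX.aemeasurable (by fun_prop)]
  · have hm : Measurable fun x : ℝ => |x| ^ p := by fun_prop
    rw [← integral_lawOfDensity hmg hg.nonneg (fun x => |x| ^ p), ← hlaw', ← hp,
      integral_map hX.aemeasurable hm.aestronglyMeasurable]

/-! ### Sums of independent variables -/

/-- Coordinatewise comparison of shifted moments passes to product measures. -/
lemma lintegral_sum_rpow_mono (p : ℝ) {n : ℕ} (μ ν : Fin n → Measure ℝ)
    [∀ i, IsProbabilityMeasure (μ i)] [∀ i, IsProbabilityMeasure (ν i)]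
    (h : ∀ i s, ∫⁻ x, ENNReal.ofReal (|x + s| ^ p) ∂(μ i)
      ≤ ∫⁻ x, ENNReal.ofReal (|x + s| ^ p) ∂(ν i)) (s : ℝ) :
    ∫⁻ x, ENNReal.ofReal (|∑ j, x j + s| ^ p) ∂(Measure.pi μ)
      ≤ ∫⁻ x, ENNReal.ofReal (|∑ j, x j + s| ^ p) ∂(Measure.pi ν) := by
  -- The shift must stay free: freezing one coordinate adds its value to the shift seen by the
  -- others.
  induction n generalizing s with
  | zero => simp
  | succ n ih =>
    set G : ℝ × (Fin n → ℝ) → ℝ≥0∞ := fun y => ENNReal.ofReal (|y.1 + (∑ j, y.2 j + s)| ^ p)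
      with hG
    have hGm : Measurable G := by fun_prop
    have split : ∀ (ρ : Fin (n + 1) → Measure ℝ) [∀ i, IsProbabilityMeasure (ρ i)],
        ∫⁻ x, ENNReal.ofReal (|∑ j, x j + s| ^ p) ∂(Measure.pi ρ)
          = ∫⁻ y, G y ∂((ρ 0).prod (Measure.pi fun j => ρ (Fin.succ j))) := by
      intro ρ _
      have hmp := measurePreserving_piFinSuccAbove ρ 0
      simp only [Fin.zero_succAbove] at hmp
      rw [← hmp.lintegral_comp hGm]
      congr 1 with x
      simp only [hG, Fin.sum_univ_succ]
      rw [add_assoc]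
      rfl
    rw [split μ, split ν]
    -- Tonelli: with the first coordinate frozen the induction hypothesis exchanges the remaining
    -- ones, then with these frozen the first is exchanged. Lower integrals make integrability
    -- unnecessary.
    calc ∫⁻ y, G y ∂((μ 0).prod (Measure.pi fun j => μ (Fin.succ j)))
        = ∫⁻ x, ∫⁻ z, G (x, z) ∂(Measure.pi fun j => μ (Fin.succ j)) ∂(μ 0) :=
          lintegral_prod _ hGm.aemeasurable
      _ ≤ ∫⁻ x, ∫⁻ z, G (x, z) ∂(Measure.pi fun j => ν (Fin.succ j)) ∂(μ 0) := by
          refine lintegral_mono fun x => ?_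
          have := ih (fun j => μ (Fin.succ j)) (fun j => ν (Fin.succ j))
            (fun i s => h _ s) (x + s)
          simpa only [hG, add_left_comm] using this
      _ = ∫⁻ z, ∫⁻ x, G (x, z) ∂(μ 0) ∂(Measure.pi fun j => ν (Fin.succ j)) :=
          lintegral_lintegral_swap hGm.aemeasurable
      _ ≤ ∫⁻ z, ∫⁻ x, G (x, z) ∂(ν 0) ∂(Measure.pi fun j => ν (Fin.succ j)) :=
          lintegral_mono fun z => by
            have := h 0 (∑ j, z j + s)
            simpa only [hG] using this
      _ = ∫⁻ y, G y ∂((ν 0).prod (Measure.pi fun j => ν (Fin.succ j))) :=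
          (lintegral_prod_symm _ hGm.aemeasurable).symm

/-- Each coordinate lies in L^p, hence so does the sum. Finiteness is needed to pass from lower
integrals to Bochner integrals, since `toReal` sends ∞ to 0. -/
lemma integrable_sum_rpow {p : ℝ} (hp : 4 < p) {n : ℕ} {a b : Fin n → ℝ} (hb : ∀ j, 0 < b j)
    {f : Fin n → ℝ → ℝ} (hf : ∀ j, IsEvenDensityWithMoments p (a j) (b j) (f j)) :
    Integrable (fun x : Fin n → ℝ => |∑ j, x j| ^ p)
      (Measure.pi fun j => lawOfDensity (f j)) := by
  have : ∀ j, IsProbabilityMeasure (lawOfDensity (f j)) := fun j =>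
    isProbabilityMeasure_lawOfDensity (hf j).logConcave.nonneg (hf j).integral_eq_one
  have hp0 : 0 < p := by linarith
  have hne : ENNReal.ofReal p ≠ 0 := by simpa using hp0
  have h1 : ∀ j, MemLp (fun x : ℝ => x) (ENNReal.ofReal p) (lawOfDensity (f j)) := by
    intro j
    refine (integrable_norm_rpow_iff aestronglyMeasurable_id hne ENNReal.ofReal_ne_top).1 ?_
    rw [ENNReal.toReal_ofReal hp0.le]
    refine not_imp_comm.1 integral_undef ?_
    simp only [Real.norm_eq_abs, id]
    rw [integral_lawOfDensity (hf j).integrable.aemeasurable (hf j).logConcave.nonneg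
      (fun x => |x| ^ p), (hf j).moments.2]
    have := hb j
    positivity
  have h2 : MemLp (fun x : Fin n → ℝ => ∑ j, x j) (ENNReal.ofReal p)
      (Measure.pi fun j => lawOfDensity (f j)) :=
    memLp_finsetSum _ fun j _ => (h1 j).comp_measurePreserving
      (measurePreserving_eval (fun j => lawOfDensity (f j)) j)
  have := h2.integrable_norm_rpow hne ENNReal.ofReal_ne_top
  rwa [ENNReal.toReal_ofReal hp0.le] at this

lemma sumMomentOfDensities_mono {p : ℝ} (hp : 4 < p) {n : ℕ} {a b : Fin n → ℝ}
    (hb : ∀ j, 0 < b j) {f g : Fin n → ℝ → ℝ}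
    (hf : ∀ j, IsEvenDensityWithMoments p (a j) (b j) (f j))
    (hg : ∀ j, IsEvenDensityWithMoments p (a j) (b j) (g j))
    (h : ∀ j s, ∫ x, |x + s| ^ p * f j x ≤ ∫ x, |x + s| ^ p * g j x) :
    sumMomentOfDensities p f ≤ sumMomentOfDensities p g := by
  have hPf : ∀ j, IsProbabilityMeasure (lawOfDensity (f j)) := fun j =>
    isProbabilityMeasure_lawOfDensity (hf j).logConcave.nonneg (hf j).integral_eq_one
  have hPg : ∀ j, IsProbabilityMeasure (lawOfDensity (g j)) := fun j =>
    isProbabilityMeasure_lawOfDensity (hg j).logConcave.nonneg (hg j).integral_eq_one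
  have key : ∀ {u : ℝ → ℝ} {j : Fin n}, IsEvenDensityWithMoments p (a j) (b j) u → ∀ s : ℝ,
      ∫⁻ x, ENNReal.ofReal (|x + s| ^ p) ∂(lawOfDensity u)
        = ENNReal.ofReal (∫ x, |x + s| ^ p * u x) := fun {u j} hu s =>
    lintegral_lawOfDensity (F := fun x => |x + s| ^ p) hu.logConcave.nonneg
      hu.integrable.aemeasurable (by fun_prop)
      (fun x => by positivity)
      (integrable_shift_rpow_mul (by linarith) hu.integrable (hu.integrable_rpow (hb j)) s)
  have hle := lintegral_sum_rpow_mono p (fun j => lawOfDensity (f j))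
    (fun j => lawOfDensity (g j)) (fun j s => by
      rw [key (hf j), key (hg j)]
      exact ENNReal.ofReal_le_ofReal (h j s)) 0
  simp only [add_zero] at hle
  have hif := integrable_sum_rpow hp hb hf
  have hig := integrable_sum_rpow hp hb hg
  have hnn : ∀ x : Fin n → ℝ, 0 ≤ |∑ j, x j| ^ p := fun x => by positivity
  rw [sumMomentOfDensities, sumMomentOfDensities,
    integral_eq_lintegral_of_nonneg_ae (Filter.Eventually.of_forall hnn) hif.aestronglyMeasurable,
    integral_eq_lintegral_of_nonneg_ae (Filter.Eventually.of_forall hnn) hig.aestronglyMeasurable]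
  exact ENNReal.toReal_mono hig.lintegral_lt_top.ne hle

/-- Every value in `sumMoments` comes from even log-concave densities. -/
lemma exists_densities_of_mem_sumMoments {p : ℝ} {n : ℕ} {a b : Fin n → ℝ} {v : ℝ}
    (hv : v ∈ sumMoments.{u} p a b) :
    ∃ f : Fin n → ℝ → ℝ, (∀ j, IsEvenDensityWithMoments p (a j) (b j) (f j)) ∧
      v = sumMomentOfDensities p f := by
  obtain ⟨Ω, _, μ, X, hμ, hX, rfl⟩ := hv
  choose f hf hlaw using fun j => exists_even_density (hX.measurable j) (hX.symmetric j)
    (hX.logConcave j) (hX.second_moment j) (hX.pth_moment j)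
  refine ⟨f, hf, ?_⟩
  have hm : Measurable fun x : Fin n → ℝ => |∑ j, x j| ^ p := by fun_prop
  have h1 := (iIndepFun_iff_map_fun_eq_pi_map fun j => (hX.measurable j).aemeasurable).1 hX.indep
  simp only [hlaw] at h1
  rw [sumMomentOfDensities, ← h1, integral_map
    (measurable_pi_lambda _ hX.measurable).aemeasurable hm.aestronglyMeasurable]

/-- Independent variables with given even log-concave densities are admissible. -/
lemma sumMomentOfDensities_mem {p : ℝ} {n : ℕ} {a b : Fin n → ℝ} {f : Fin n → ℝ → ℝ}
    (hf : ∀ j, IsEvenDensityWithMoments p (a j) (b j) (f j))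
    (hlc : ∀ j, IsLogConcaveDensity (f j)) :
    sumMomentOfDensities p f ∈ sumMoments.{u} p a b := by
  have hP : ∀ j, IsProbabilityMeasure (lawOfDensity (f j)) := fun j =>
    isProbabilityMeasure_lawOfDensity (hf j).logConcave.nonneg (hf j).integral_eq_one
  set π := Measure.pi fun j => lawOfDensity (f j) with hπ
  -- `sumMoments` ranges over probability spaces in universe `u`, so the product space is lifted
  -- there.
  set μ : Measure (ULift.{u} (Fin n → ℝ)) := π.map ULift.up with hμ
  have hup : Measurable (ULift.up : (Fin n → ℝ) → ULift.{u} (Fin n → ℝ)) := measurable_up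
  have hdown : Measurable (ULift.down : ULift.{u} (Fin n → ℝ) → Fin n → ℝ) := measurable_down
  have hXm : ∀ j, Measurable fun ω : ULift.{u} (Fin n → ℝ) => ω.down j := fun j =>
    (measurable_pi_apply j).comp hdown
  have hprob : IsProbabilityMeasure μ := Measure.isProbabilityMeasure_map hup.aemeasurable
  have hlaw : ∀ j, μ.map (fun ω => ω.down j) = lawOfDensity (f j) := fun j => by
    rw [hμ, Measure.map_map (hXm j) hup]
    exact (measurePreserving_eval (fun j => lawOfDensity (f j)) j).map_eq
  have hm2 : Measurable fun x : ℝ => x ^ 2 := by fun_prop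
  have hmp : Measurable fun x : ℝ => |x| ^ p := by fun_prop
  have hms : Measurable fun ω : ULift.{u} (Fin n → ℝ) => |∑ j, ω.down j| ^ p := by
    have : Measurable fun x : Fin n → ℝ => |∑ j, x j| ^ p := by fun_prop
    exact this.comp hdown
  refine ⟨ULift.{u} (Fin n → ℝ), inferInstance, μ, fun j ω => ω.down j, hprob,
    ⟨hXm, ?_, fun j => ⟨(hXm j).aemeasurable, (hXm j).neg.aemeasurable, ?_⟩,
      fun j => ⟨f j, hlc j, hlaw j⟩, fun j => ?_, fun j => ?_⟩, ?_⟩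
  · rw [iIndepFun_iff_map_fun_eq_pi_map fun j => (hXm j).aemeasurable]
    simp only [hlaw]
    rw [hμ, Measure.map_map (measurable_pi_lambda _ hXm) hup]
    exact Measure.map_id
  · have : μ.map (fun ω => -ω.down j) = (μ.map fun ω => ω.down j).map fun x => -x :=
      (Measure.map_map measurable_neg (hXm j)).symm
    rw [this, hlaw, map_neg_lawOfDensity]
    simp only [(hf j).logConcave.even]
  · rw [← (hf j).moments.1, ← integral_lawOfDensity (hf j).integrable.aemeasurable
      (hf j).logConcave.nonneg, ← hlaw j, integral_map (hXm j).aemeasurable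
      hm2.aestronglyMeasurable]
  · rw [← (hf j).moments.2, ← integral_lawOfDensity (hf j).integrable.aemeasurable
      (hf j).logConcave.nonneg (fun x => |x| ^ p), ← hlaw j, integral_map (hXm j).aemeasurable
      hmp.aestronglyMeasurable]
  · rw [hμ, integral_map hup.aemeasurable hms.aestronglyMeasurable, sumMomentOfDensities]

end LogConcaveRosenthal

end

theorem theorem6 (p : ℝ) (hp : 4 < p) (n : ℕ) (hn : 1 ≤ n) (a b : Fin n → ℝ)
    (ha : ∀ j, 0 < a j) (hb : ∀ j, 0 < b j)
    (hlow : ∀ j, (3 : ℝ) ^ (1 / 2 : ℝ) * (p + 1) ^ (-(1 / p)) ≤ b j / a j)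
    (hupp : ∀ j, b j / a j ≤ (2 : ℝ) ^ (-(1 / 2) : ℝ) * Real.Gamma (p + 1) ^ (1 / p)) :
    ∃ fminus fplus : Fin n → ℝ → ℝ,
      (∀ j, LogConcaveRosenthal.IsUniqueDensity LogConcaveRosenthal.familyMinus
        p (a j) (b j) (fminus j)) ∧
      (∀ j, LogConcaveRosenthal.IsUniqueDensity LogConcaveRosenthal.familyPlus
        p (a j) (b j) (fplus j)) ∧
      IsLeast (LogConcaveRosenthal.sumMoments.{u} p a b)
        (LogConcaveRosenthal.sumMomentOfDensities p fminus) ∧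
      IsGreatest (LogConcaveRosenthal.sumMoments.{u} p a b)
        (LogConcaveRosenthal.sumMomentOfDensities p fplus) := by
  open LogConcaveRosenthal in
  choose fm hfm hmm using fun j => exists_mem_familyMinus hp (ha j) (hb j) (hlow j) (hupp j)
  choose fp hfp hmp using fun j => exists_mem_familyPlus hp (ha j) (hb j) (hlow j) (hupp j)
  have em := fun j => isEvenDensityWithMoments_of_mem_familyMinus (hfm j) (hmm j)
  have ep := fun j => isEvenDensityWithMoments_of_mem_familyPlus (hfp j) (hmp j)
  refine ⟨fm, fp, fun j => isUniqueDensity_familyMinus hp (ha j) (hb j) (hfm j) (hmm j),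
    fun j => isUniqueDensity_familyPlus hp (ha j) (hb j) (hfp j) (hmp j),
    ⟨sumMomentOfDensities_mem em fun j =>
      (isClosedLogConcave_of_mem_familyMinus (hfm j)).isLogConcaveDensity, fun v hv => ?_⟩,
    ⟨sumMomentOfDensities_mem ep fun j =>
      (isClosedLogConcave_of_mem_familyPlus (hfp j)).isLogConcaveDensity, fun v hv => ?_⟩⟩
  · obtain ⟨f, hf, rfl⟩ := exists_densities_of_mem_sumMoments hv
    refine sumMomentOfDensities_mono hp hb em hf fun j s => ?_
    obtain ⟨_, hflat⟩ := isFlatThenLogConvex_of_mem_familyMinus (hfm j)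
    exact (hf j).integral_shift_le hp (ha j) (hb j) (em j)
      ((hf j).logConcave.noAlternation_sub_flat hflat) s
  · obtain ⟨f, hf, rfl⟩ := exists_densities_of_mem_sumMoments hv
    refine sumMomentOfDensities_mono hp hb hf ep fun j s => ?_
    exact (ep j).integral_shift_le hp (ha j) (hb j) (hf j)
      ((hf j).logConcave.noAlternation_logConvex_sub
        (isLogConvexOnSupport_of_mem_familyPlus (hfp j))) s
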